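/- A weighted bicolored plane tree (a tree, for short) is a finite tree whose vertices are properly colored black and white, with a cyclic order of the edges around each vertex and a positive integer weight on each edge; its weight is the sum of the weights of its edges. The vertex of the one-vertex tree is left uncolored, so there is a single tree without edges. Isomorphisms preserve colors, cyclic orders and weights, and trees are counted up to isomorphism. A rooted tree is a tree with a distinguished edge, which isomorphisms of rooted trees preserve; the tree without edges also counts as one rooted tree. **Theorem (Enumeration of weighted trees).** Let $a_n$ be the (finite) number of rooted trees of weight $n$. As a formal power series, the generating function $f(t)=\sum_{n\ge 0}a_nt^n$ equals $$f(t)=\frac{1-t-\sqrt{1-6t+5t^2}}{2t}=1+t+3t^2+10t^3+36t^4+137t^5+543t^6+2219t^7+9285t^8+\cdots,$$ where the square root is the one with constant term $1$. Moreover $a_0=a_1=1$, $$a_{n+1}=a_n+\sum_{k=0}^n a_ka_{n-k}\quad (n\ge 1),\qquad\text{and}\qquad a_n\sim\frac12\sqrt{\frac5\pi}\cdot 5^n\,n^{-3/2}\quad (n\to\infty).$$ Let $b_{m,n}$ be the number of rooted trees of weight $n$ with $m$ edges. As a formal power series, $h(s,t)=\sum_{m,n\ge 0}b_{m,n}s^mt^n$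 equals $$h(s,t)=\frac{1-t-\sqrt{1-(2+4s)t+(1+4s)t^2}}{2st}=1+st+(s+2s^2)t^2+(s+4s^2+5s^3)t^3+(s+6s^2+15s^3+14s^4)t^4+\cdots,$$ again with the square root of constant term $1$. For $m,n\ge 1$, $$b_{m,n}=\binom{n-1}{m-1}\,\mathrm{Cat}_m=\binom{n-1}{m-1}\cdot\frac{1}{m+1}\binom{2m}{m},$$ where $\mathrm{Cat}_m$ is the $m$th Catalan number, while $b_{0,0}=1$ and $b_{m,n}=0$ if exactly one of $m,n$ is $0$. Finally, for a non-rooted tree $T$ let $|\mathrm{Aut}(T)|$ be the order of its automorphism group. For every $n\ge 1$, there are finitely many non-isomorphic non-rooted trees $T$ of weight $n$, and $$\sum_T\frac1{|\mathrm{Aut}(T)|}=\sum_{m=1}^n\frac{b_{m,n}}{m},$$ where the first sum is over these trees. -/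

import Mathlib

/-- A weighted bicolored plane tree: a finite tree on the vertex set `Vertex` whose edges
(the elements of `Edge`) each join a black vertex to a white vertex and carry a positive integer
weight, together with a cyclic order of the edges around each vertex.
`nextAtBlack e` is the successor of `e` in the cyclic order around the black end of `e`, and
`nextAtWhite e` is its successor around the white end.
A vertex is black (white) if it is the black (white) end of some edge; so the vertex of the
tree without edges has no colour. -/
structure WeightedTree where
  Vertex : Type
  Edge : Type
  finite_vertex : Finite Vertex
  finite_edge : Finite Edge
  blackEnd : Edge → Vertex
  whiteEnd : Edge → Vertex
  /-- No vertex is both black and white. -/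
  bicolored : ∀ e e', blackEnd e ≠ whiteEnd e'
  /-- There are no parallel edges. -/
  simple : ∀ e e', blackEnd e = blackEnd e' → whiteEnd e = whiteEnd e' → e = e'
  /-- The underlying graph is a tree. -/
  isTree : (SimpleGraph.fromRel fun u v => ∃ e, blackEnd e = u ∧ whiteEnd e = v).IsTree
  nextAtBlack : Equiv.Perm Edge
  nextAtWhite : Equiv.Perm Edge
  /-- The edges incident to a black vertex form exactly one cycle of `nextAtBlack`. -/
  sameCycle_black : ∀ e e', nextAtBlack.SameCycle e e' ↔ blackEnd e = blackEnd e'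
  /-- The edges incident to a white vertex form exactly one cycle of `nextAtWhite`. -/
  sameCycle_white : ∀ e e', nextAtWhite.SameCycle e e' ↔ whiteEnd e = whiteEnd e'
  weight : Edge → ℕ+

namespace WeightedTree

/-- The sum of the weights of the edges (a finite sum, since `Edge` is finite). -/
noncomputable def totalWeight (T : WeightedTree) : ℕ := ∑ᶠ e : T.Edge, (T.weight e : ℕ)

/-- The number of edges. -/
noncomputable def numEdges (T : WeightedTree) : ℕ := Nat.card T.Edge

/-- Isomorphisms of weighted bicolored plane trees: they preserve incidence, colours, cyclic
orders and weights. -/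
@[ext] structure Iso (T T' : WeightedTree) where
  vertex : T.Vertex ≃ T'.Vertex
  edge : T.Edge ≃ T'.Edge
  map_blackEnd : ∀ e, T'.blackEnd (edge e) = vertex (T.blackEnd e)
  map_whiteEnd : ∀ e, T'.whiteEnd (edge e) = vertex (T.whiteEnd e)
  map_nextAtBlack : ∀ e, T'.nextAtBlack (edge e) = edge (T.nextAtBlack e)
  map_nextAtWhite : ∀ e, T'.nextAtWhite (edge e) = edge (T.nextAtWhite e)
  map_weight : ∀ e, T'.weight (edge e) = T.weight e

namespace Iso

def refl (T : WeightedTree) : Iso T T :=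
  ⟨Equiv.refl _, Equiv.refl _, fun _ => rfl, fun _ => rfl, fun _ => rfl, fun _ => rfl,
    fun _ => rfl⟩

def trans {T T' T'' : WeightedTree} (f : Iso T T') (g : Iso T' T'') : Iso T T'' where
  vertex := f.vertex.trans g.vertex
  edge := f.edge.trans g.edge
  map_blackEnd e := by simp [g.map_blackEnd, f.map_blackEnd]
  map_whiteEnd e := by simp [g.map_whiteEnd, f.map_whiteEnd]
  map_nextAtBlack e := by simp [g.map_nextAtBlack, f.map_nextAtBlack]
  map_nextAtWhite e := by simp [g.map_nextAtWhite, f.map_nextAtWhite]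
  map_weight e := by simp [g.map_weight, f.map_weight]

def symm {T T' : WeightedTree} (f : Iso T T') : Iso T' T where
  vertex := f.vertex.symm
  edge := f.edge.symm
  map_blackEnd e := by rw [Equiv.eq_symm_apply, ← f.map_blackEnd, Equiv.apply_symm_apply]
  map_whiteEnd e := by rw [Equiv.eq_symm_apply, ← f.map_whiteEnd, Equiv.apply_symm_apply]
  map_nextAtBlack e := by
    rw [Equiv.eq_symm_apply, ← f.map_nextAtBlack, Equiv.apply_symm_apply]
  map_nextAtWhite e := by
    rw [Equiv.eq_symm_apply, ← f.map_nextAtWhite, Equiv.apply_symm_apply]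
  map_weight e := by rw [← f.map_weight, Equiv.apply_symm_apply]

end Iso

/-- The automorphism group of a tree, under composition. -/
abbrev Aut (T : WeightedTree) : Type := Iso T T

instance (T : WeightedTree) : Group (Aut T) where
  mul f g := g.trans f
  one := Iso.refl T
  inv f := f.symm
  mul_assoc _ _ _ := rfl
  one_mul _ := rfl
  mul_one _ := rfl
  inv_mul_cancel f :=
    Iso.ext (Equiv.self_trans_symm f.vertex) (Equiv.self_trans_symm f.edge)

/-- Trees up to isomorphism. -/
instance isoSetoid : Setoid WeightedTree where
  r T T' := Nonempty (Iso T T')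
  iseqv :=
    ⟨fun T => ⟨Iso.refl T⟩, fun ⟨f⟩ => ⟨f.symm⟩, fun ⟨f⟩ ⟨g⟩ => ⟨f.trans g⟩⟩

/-- The order of the automorphism group, as a function of the isomorphism class. -/
noncomputable def autOrder : Quotient isoSetoid → ℕ :=
  Quotient.lift (fun T => Nat.card (Aut T)) (by
    rintro T T' ⟨f⟩
    refine Nat.card_congr
      ⟨fun g => (f.symm.trans g).trans f, fun g => (f.trans g).trans f.symm, ?_, ?_⟩
    · intro g
      apply Iso.ext <;> ext x <;> simp [Iso.trans, Iso.symm]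
    · intro g
      apply Iso.ext <;> ext x <;> simp [Iso.trans, Iso.symm])

/-- The isomorphism classes of (non-rooted) trees of total weight `n`. -/
def classes (n : ℕ) : Set (Quotient isoSetoid) :=
  {q | ∃ T : WeightedTree, Quotient.mk isoSetoid T = q ∧ T.totalWeight = n}

end WeightedTree

/-- The number of non-isomorphic non-rooted trees of total weight `n`, each counted with the
factor `1 / |Aut T|`. -/
noncomputable def unrootedCount (n : ℕ) : ℚ :=
  ∑ᶠ q ∈ WeightedTree.classes n, 1 / (WeightedTree.autOrder q : ℚ)

/-- A rooted tree: a tree with a distinguished edge. The only tree without a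
distinguished edge that is admitted is the tree without edges. -/
structure RootedWeightedTree extends WeightedTree where
  root : Option Edge
  isEmpty_of_root_eq_none : root = none → IsEmpty Edge

namespace RootedWeightedTree

/-- Rooted trees up to isomorphisms that carry root to root. -/
instance isoSetoid : Setoid RootedWeightedTree where
  r T T' := ∃ f : WeightedTree.Iso T.toWeightedTree T'.toWeightedTree,
    T.root.map f.edge = T'.root
  iseqv := by
    refine ⟨fun T => ⟨WeightedTree.Iso.refl _, ?_⟩, ?_, ?_⟩
    · simp [WeightedTree.Iso.refl]
    · rintro T T' ⟨f, hf⟩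
      refine ⟨f.symm, ?_⟩
      simp [← hf, WeightedTree.Iso.symm, Option.map_map]
    · rintro T T' T'' ⟨f, hf⟩ ⟨g, hg⟩
      refine ⟨f.trans g, ?_⟩
      simp [← hg, ← hf, WeightedTree.Iso.trans, Option.map_map]

/-- The isomorphism classes of rooted trees of total weight `n`. -/
def classes (n : ℕ) : Set (Quotient isoSetoid) :=
  {q | ∃ T : RootedWeightedTree, Quotient.mk isoSetoid T = q ∧ T.totalWeight = n}

/-- The isomorphism classes of rooted trees of total weight `n` with `m` edges. -/
def classesWithEdges (m n : ℕ) : Set (Quotient isoSetoid) :=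
  {q | ∃ T : RootedWeightedTree,
    Quotient.mk isoSetoid T = q ∧ T.totalWeight = n ∧ T.numEdges = m}

end RootedWeightedTree

/-- The number `a n` of rooted weighted trees of total weight `n`. -/
noncomputable def rootedCount (n : ℕ) : ℕ := (RootedWeightedTree.classes n).ncard

/-- The number `b m n` of rooted weighted trees of total weight `n` with `m` edges. -/
noncomputable def rootedEdgeCount (m n : ℕ) : ℕ :=
  (RootedWeightedTree.classesWithEdges m n).ncard

/-- The generating function of `rootedCount`, as a formal power series in `t`. -/
noncomputable def rootedSeries : PowerSeries ℚ := PowerSeries.mk fun n => (rootedCount n : ℚ)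

/-- The generating function of `rootedEdgeCount`, as a formal power series in
`s` (variable `0`) and `t` (variable `1`). -/
noncomputable def rootedEdgeSeries : MvPowerSeries (Fin 2) ℚ :=
  fun d => (rootedEdgeCount (d 0) (d 1) : ℚ)

/-!
A rooted tree is cut by the deletion of its root edge `e` into two smaller trees: the component of
the black end of `e`, which is rooted at the successor of `e` around this end, and the component of
the white end, rooted likewise; a component is the tree without edges if `e` has no other successor
than itself. The cyclic orders skip `e`. Conversely, two rooted trees are joined by a new root edge
that is inserted just before their roots (`RootedWeightedTree.join`). Iterating the cut shows that
isomorphism classes of rooted trees are the same as binary trees with node labels in `ℕ+`, the nodes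
being the edges and the labels their weights (`RootedWeightedTree.classEquiv`). Injectivity rests on
the transitivity of the two permutations on the edges (`WeightedTree.edge_induction`), surjectivity
on the fact that every edge is a bridge (`RootedWeightedTree.join_parts_equiv`).

The decomposition of binary trees at the root gives `(1 - t) (h - 1) = s t h ^ 2` for the bivariate
generating function `h`, and `(1 - t) (f - 1) = t f ^ 2` for the generating function by weight alone
(`BinaryTree.enumerator_eq`). Completing the square gives the closed forms. Comparing coefficients
gives the recurrence for `a n`, and shows that the rooted trees with `m` edges have the generating
function `catalan m * (t / (1 - t)) ^ m`, hence the formula for `b m n`.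

For the asymptotics, `n (n + 1) a n = (5 ^ (n + 1) / 4) E[V]`, where the mean is over the binomial
distribution with parameters `n + 1` and `4 / 5`, and `V j = √(j / π) + O(1)` by Wallis' bounds for
the central binomial coefficient. As the binomial distribution has a standard deviation of the
order of the square root of its mean, `E[V] = √(4 n / 5 π) + O(1)`.

The automorphism group of a tree acts freely on its edges, again by transitivity, so a tree `T` with
`m ≥ 1` edges has `m / |Aut T|` inequivalent rootings. Summing `1 / m` over all rooted trees of
weight `n` gives the last formula.
-/

/-! ### Cycles of permutations -/

/-- An injection that intertwines two permutations preserves and reflects their cycles. -/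
theorem Equiv.Perm.sameCycle_map_iff {α β : Type*} {π : Equiv.Perm α} {ρ : Equiv.Perm β}
    {f : α → β} (hf : Function.Injective f) (h : ∀ x, ρ (f x) = f (π x)) {x y : α} :
    ρ.SameCycle (f x) (f y) ↔ π.SameCycle x y := by
  have hpow : ∀ (n : ℕ) z, (ρ ^ n) (f z) = f ((π ^ n) z) := by
    intro n
    induction n with
    | zero => simp
    | succ n ih => intro z; rw [pow_succ', pow_succ', Perm.mul_apply, Perm.mul_apply, ih, h]
  have hzpow : ∀ (n : ℤ), (ρ ^ n) (f x) = f ((π ^ n) x) := by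
    rintro (n | n)
    · simpa using hpow n x
    · rw [zpow_negSucc, zpow_negSucc, Perm.inv_eq_iff_eq, hpow, ← Perm.mul_apply, mul_inv_cancel,
        Perm.one_apply]
  simp only [Perm.SameCycle, hzpow, hf.eq_iff]

/-- A property that is preserved by a permutation of a finite type is constant along cycles. -/
theorem Equiv.Perm.SameCycle.induction_on {α : Type*} [Finite α] {π : Equiv.Perm α}
    {P : α → Prop} (hP : ∀ z, P z → P (π z)) {x y : α} (h : π.SameCycle x y) (hx : P x) : P y := by
  obtain ⟨i, -, rfl⟩ := h.exists_pow_eq'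
  induction i with
  | zero => simpa using hx
  | succ i ih => rw [pow_succ', Perm.mul_apply]; exact hP _ (ih ⟨i, by simp⟩)

/-- Inserting a fixed point `e` of `τ` into one of the cycles of `τ` does not change which of the
other points lie on a common cycle. -/
theorem Equiv.Perm.sameCycle_swap_mul_iff {α : Type*} [Finite α] [DecidableEq α]
    {τ : Equiv.Perm α} {e a : α} (he : τ e = e) {x y : α} (hx : x ≠ e) (hy : y ≠ e) :
    (Equiv.swap e a * τ).SameCycle x y ↔ τ.SameCycle x y := by
  constructor
  · intro h
    -- On the larger cycle, the invariant at the inserted point `e` is that its successor `a` lies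
    -- on the cycle of `x`.
    have key : (y ≠ e → τ.SameCycle x y) ∧ (y = e → τ.SameCycle x a) := by
      refine h.induction_on (P := fun z => (z ≠ e → τ.SameCycle x z) ∧
        (z = e → τ.SameCycle x a)) ?_ ⟨fun _ => .rfl, fun h => absurd h hx⟩
      rintro z ⟨h1, h2⟩
      by_cases hz : z = e
      · subst hz
        simp only [Perm.mul_apply, he, swap_apply_left]
        exact ⟨fun _ => h2 rfl, fun _ => h2 rfl⟩
      · have hτ : τ z ≠ e := fun h => hz (τ.injective (h.trans he.symm))
        have hs : τ.SameCycle x (τ z) := Perm.sameCycle_apply_right.2 (h1 hz)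
        simp only [Perm.mul_apply]
        by_cases hza : τ z = a
        · rw [hza, swap_apply_right]
          exact ⟨fun h => absurd rfl h, fun _ => hza ▸ hs⟩
        · rw [swap_apply_of_ne_of_ne hτ hza]
          exact ⟨fun _ => hs, fun h => absurd h hτ⟩
    exact key.1 hy
  · intro h
    have key : y ≠ e ∧ (Equiv.swap e a * τ).SameCycle x y := by
      refine h.induction_on (P := fun z => z ≠ e ∧ (Equiv.swap e a * τ).SameCycle x z) ?_
        ⟨hx, .rfl⟩
      rintro z ⟨hz, hs⟩
      have hτ : τ z ≠ e := fun h => hz (τ.injective (h.trans he.symm))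
      refine ⟨hτ, ?_⟩
      have hs' := Perm.sameCycle_apply_right.2 hs
      rw [Perm.mul_apply] at hs'
      by_cases hza : τ z = a
      · have hs'' := Perm.sameCycle_apply_right.2 hs'
        rw [hza, swap_apply_right, Perm.mul_apply, he, swap_apply_left] at hs''
        rwa [hza]
      · rwa [swap_apply_of_ne_of_ne hτ hza] at hs'
    exact key.2

/-! ### The underlying graph of a tree -/

namespace WeightedTree

attribute [instance] finite_vertex finite_edge

section Graph

variable {V E : Type} (b w : E → V)

/-- The graph on `V` in which each `e : E` joins `b e` to `w e`. -/
abbrev endsGraph : SimpleGraph V := SimpleGraph.fromRel fun u v => ∃ e, b e = u ∧ w e = v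

variable {b w} (hbw : ∀ e e', b e ≠ w e')
include hbw

theorem endsGraph_adj {u v : V} :
    (endsGraph b w).Adj u v ↔ ∃ e, (b e = u ∧ w e = v) ∨ (b e = v ∧ w e = u) := by
  rw [SimpleGraph.fromRel_adj]
  constructor
  · rintro ⟨-, ⟨e, h⟩ | ⟨e, h⟩⟩
    exacts [⟨e, .inl h⟩, ⟨e, .inr h⟩]
  · rintro ⟨e, ⟨rfl, rfl⟩ | ⟨rfl, rfl⟩⟩
    exacts [⟨hbw _ _, .inl ⟨e, rfl, rfl⟩⟩, ⟨(hbw _ _).symm, .inr ⟨e, rfl, rfl⟩⟩]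

theorem endsGraph_adj_ends (e : E) : (endsGraph b w).Adj (b e) (w e) :=
  (endsGraph_adj hbw).2 ⟨e, .inl ⟨rfl, rfl⟩⟩

theorem endsGraph_reachable_induction {Q : V → Prop} (hQ : ∀ e, Q (b e) ↔ Q (w e)) {u v : V}
    (h : (endsGraph b w).Reachable u v) (hu : Q u) : Q v := by
  obtain ⟨p⟩ := h
  induction p with
  | nil => exact hu
  | cons h _ ih =>
    apply ih
    obtain ⟨e, ⟨rfl, rfl⟩ | ⟨rfl, rfl⟩⟩ := (endsGraph_adj hbw).1 h
    exacts [(hQ e).1 hu, (hQ e).2 hu]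

theorem card_edgeSet_endsGraph (hs : ∀ e e', b e = b e' → w e = w e' → e = e') :
    Nat.card (endsGraph b w).edgeSet = Nat.card E := by
  symm
  refine Nat.card_congr (Equiv.ofBijective
    (fun e => ⟨s(b e, w e), (endsGraph_adj_ends hbw e)⟩) ⟨?_, ?_⟩)
  · intro e e' h
    rcases Sym2.eq_iff.1 (congrArg Subtype.val h) with ⟨h1, h2⟩ | ⟨h1, h2⟩
    exacts [hs _ _ h1 h2, absurd h1 (hbw _ _)]
  · rintro ⟨x, hx⟩
    induction x with
    | _ u v =>
      obtain ⟨e, ⟨rfl, rfl⟩ | ⟨rfl, rfl⟩⟩ := (endsGraph_adj hbw).1 hx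
      exacts [⟨e, rfl⟩, ⟨e, Subtype.ext Sym2.eq_swap⟩]

end Graph

variable (T : WeightedTree)

/-- The underlying simple graph of a tree. -/
abbrev graph : SimpleGraph T.Vertex := endsGraph T.blackEnd T.whiteEnd

theorem graph_isTree : T.graph.IsTree := T.isTree

instance : Nonempty T.Vertex := T.isTree.1.nonempty

theorem card_edge_add_one : Nat.card T.Edge + 1 = Nat.card T.Vertex := by
  rw [← card_edgeSet_endsGraph T.bicolored T.simple]
  exact (SimpleGraph.isTree_iff_connected_and_card.1 T.isTree).2

variable {T}

theorem vertex_induction {Q : T.Vertex → Prop} (hQ : ∀ e, Q (T.blackEnd e) ↔ Q (T.whiteEnd e))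
    {u : T.Vertex} (hu : Q u) (v : T.Vertex) : Q v :=
  endsGraph_reachable_induction T.bicolored hQ (T.graph_isTree.1 u v) hu

theorem subsingleton_vertex [IsEmpty T.Edge] : Subsingleton T.Vertex :=
  ⟨fun u v => vertex_induction (Q := fun z => u = z) (fun e => isEmptyElim e) rfl v⟩

theorem exists_edge_at [h : Nonempty T.Edge] (v : T.Vertex) :
    ∃ e, T.blackEnd e = v ∨ T.whiteEnd e = v := by
  obtain ⟨e₀⟩ := h
  exact vertex_induction (Q := fun v => ∃ e, T.blackEnd e = v ∨ T.whiteEnd e = v)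
    (fun e => ⟨fun _ => ⟨e, .inr rfl⟩, fun _ => ⟨e, .inl rfl⟩⟩) ⟨e₀, .inl rfl⟩ v

/-- The two permutations act transitively on the edges, because the graph is connected. -/
theorem edge_induction {P : T.Edge → Prop} (hb : ∀ e, P e → P (T.nextAtBlack e))
    (hw : ∀ e, P e → P (T.nextAtWhite e)) {e₀ : T.Edge} (h₀ : P e₀) (e : T.Edge) : P e := by
  have hb' : ∀ x y, T.blackEnd x = T.blackEnd y → P x → P y := fun x y h hx =>
    ((T.sameCycle_black x y).2 h).induction_on hb hx
  have hw' : ∀ x y, T.whiteEnd x = T.whiteEnd y → P x → P y := fun x y h hx =>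
    ((T.sameCycle_white x y).2 h).induction_on hw hx
  have key := vertex_induction (T := T)
    (Q := fun v => ∀ x, T.blackEnd x = v ∨ T.whiteEnd x = v → P x) (u := T.blackEnd e₀) ?_ ?_
    (T.blackEnd e) e (.inl rfl)
  · exact key
  · intro e
    constructor
    · rintro h x (hx | hx)
      · exact absurd hx (T.bicolored _ _)
      · exact hw' _ _ hx.symm (h e (.inl rfl))
    · rintro h x (hx | hx)
      · exact hb' _ _ hx.symm (h e (.inr rfl))
      · exact absurd hx.symm (T.bicolored _ _)
  · rintro x (hx | hx)
    · exact hb' _ _ hx.symm h₀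
    · exact absurd hx.symm (T.bicolored _ _)

/-! ### Isomorphisms are determined by their action on edges -/

variable {T' : WeightedTree}

theorem exists_vertex_map (f : T.Edge → T'.Edge)
    (hb : ∀ x y, T.blackEnd x = T.blackEnd y → T'.blackEnd (f x) = T'.blackEnd (f y))
    (hw : ∀ x y, T.whiteEnd x = T.whiteEnd y → T'.whiteEnd (f x) = T'.whiteEnd (f y)) :
    ∃ φ : T.Vertex → T'.Vertex, (∀ e, φ (T.blackEnd e) = T'.blackEnd (f e)) ∧
      ∀ e, φ (T.whiteEnd e) = T'.whiteEnd (f e) := by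
  classical
  refine ⟨fun v => if h : ∃ e, T.blackEnd e = v then T'.blackEnd (f h.choose) else
    if h' : ∃ e, T.whiteEnd e = v then T'.whiteEnd (f h'.choose)
    else Classical.arbitrary _, fun e => ?_, fun e => ?_⟩
  · have h : ∃ x, T.blackEnd x = T.blackEnd e := ⟨e, rfl⟩
    simp only [dif_pos h]
    exact hb _ _ h.choose_spec
  · have h : ¬ ∃ x, T.blackEnd x = T.whiteEnd e := fun ⟨x, hx⟩ => T.bicolored _ _ hx
    have h' : ∃ x, T.whiteEnd x = T.whiteEnd e := ⟨e, rfl⟩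
    simp only [dif_neg h, dif_pos h']
    exact hw _ _ h'.choose_spec

/-- A bijection of edges that respects both permutations and the weights extends to an
isomorphism: the vertices are the cycles of the permutations. -/
theorem exists_iso_of_edge (f : T.Edge ≃ T'.Edge)
    (hb : ∀ e, T'.nextAtBlack (f e) = f (T.nextAtBlack e))
    (hw : ∀ e, T'.nextAtWhite (f e) = f (T.nextAtWhite e))
    (hwt : ∀ e, T'.weight (f e) = T.weight e) : ∃ g : Iso T T', g.edge = f := by
  have hb' : ∀ x y, T'.blackEnd (f x) = T'.blackEnd (f y) ↔ T.blackEnd x = T.blackEnd y := by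
    intro x y
    rw [← T.sameCycle_black, ← T'.sameCycle_black, Equiv.Perm.sameCycle_map_iff f.injective hb]
  have hw' : ∀ x y, T'.whiteEnd (f x) = T'.whiteEnd (f y) ↔ T.whiteEnd x = T.whiteEnd y := by
    intro x y
    rw [← T.sameCycle_white, ← T'.sameCycle_white, Equiv.Perm.sameCycle_map_iff f.injective hw]
  rcases isEmpty_or_nonempty T.Edge with hE | hE
  · have hE' : IsEmpty T'.Edge := f.symm.isEmpty
    have := subsingleton_vertex (T := T)
    have := subsingleton_vertex (T := T')
    exact ⟨⟨equivOfSubsingletonOfSubsingleton (fun _ => Classical.arbitrary _)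
      (fun _ => Classical.arbitrary _), f, fun e => isEmptyElim e, fun e => isEmptyElim e, hb, hw,
      hwt⟩, rfl⟩
  · have hE' : Nonempty T'.Edge := hE.map f
    obtain ⟨φ, hφb, hφw⟩ := exists_vertex_map f (fun x y => (hb' x y).2) (fun x y => (hw' x y).2)
    obtain ⟨ψ, hψb, hψw⟩ := exists_vertex_map f.symm
      (fun x y h => (hb' _ _).1 (by simpa using h)) (fun x y h => (hw' _ _).1 (by simpa using h))
    refine ⟨⟨⟨φ, ψ, fun v => ?_, fun v => ?_⟩, f, fun e => (hφb e).symm, fun e => (hφw e).symm, hb,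
      hw, hwt⟩, rfl⟩
    · obtain ⟨e, rfl | rfl⟩ := exists_edge_at v
      · rw [hφb, hψb, f.symm_apply_apply]
      · rw [hφw, hψw, f.symm_apply_apply]
    · obtain ⟨e, rfl | rfl⟩ := exists_edge_at v
      · rw [hψb, hφb, f.apply_symm_apply]
      · rw [hψw, hφw, f.apply_symm_apply]

/-- An isomorphism is determined by the image of one edge. -/
theorem Iso.ext_of_edge {f g : Iso T T'} {e₀ : T.Edge} (h : f.edge e₀ = g.edge e₀) : f = g := by
  have hE : ∀ e, f.edge e = g.edge e := by
    refine edge_induction (fun e he => ?_) (fun e he => ?_) h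
    · rw [← f.map_nextAtBlack, ← g.map_nextAtBlack, he]
    · rw [← f.map_nextAtWhite, ← g.map_nextAtWhite, he]
  have : Nonempty T.Edge := ⟨e₀⟩
  refine Iso.ext (Equiv.ext fun v => ?_) (Equiv.ext hE)
  obtain ⟨e, rfl | rfl⟩ := exists_edge_at v
  · rw [← f.map_blackEnd, ← g.map_blackEnd, hE]
  · rw [← f.map_whiteEnd, ← g.map_whiteEnd, hE]

theorem Iso.totalWeight_eq (f : Iso T T') : T'.totalWeight = T.totalWeight := by
  unfold totalWeight
  rw [← finsum_comp_equiv f.edge]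
  simp only [f.map_weight]

theorem Iso.numEdges_eq (f : Iso T T') : T'.numEdges = T.numEdges :=
  (Nat.card_congr f.edge).symm

end WeightedTree

namespace RootedWeightedTree

/-- The version of `WeightedTree.exists_iso_of_edge` for rooted trees. -/
theorem equiv_of_edge {T T' : RootedWeightedTree} (f : T.Edge ≃ T'.Edge)
    (hb : ∀ e, T'.nextAtBlack (f e) = f (T.nextAtBlack e))
    (hw : ∀ e, T'.nextAtWhite (f e) = f (T.nextAtWhite e))
    (hwt : ∀ e, T'.weight (f e) = T.weight e) (hr : T.root.map f = T'.root) : T ≈ T' := by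
  obtain ⟨g, rfl⟩ := WeightedTree.exists_iso_of_edge f hb hw hwt
  exact ⟨g, hr⟩

end RootedWeightedTree

/-! ### Joining two rooted trees by a new root edge -/

namespace RootedWeightedTree

open WeightedTree

/-- The black end of the root, or the only vertex if there are no edges. -/
noncomputable def rootBlack (T : RootedWeightedTree) : T.Vertex :=
  T.root.elim (Classical.arbitrary _) T.blackEnd

/-- The white end of the root, or the only vertex if there are no edges. -/
noncomputable def rootWhite (T : RootedWeightedTree) : T.Vertex :=
  T.root.elim (Classical.arbitrary _) T.whiteEnd

theorem rootBlack_ne_whiteEnd (T : RootedWeightedTree) (e : T.Edge) :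
    T.rootBlack ≠ T.whiteEnd e := by
  unfold rootBlack
  cases h : T.root with
  | none => exact (T.isEmpty_of_root_eq_none h).elim e
  | some r => exact T.bicolored r e

theorem rootWhite_ne_blackEnd (T : RootedWeightedTree) (e : T.Edge) :
    T.rootWhite ≠ T.blackEnd e := by
  unfold rootWhite
  cases h : T.root with
  | none => exact (T.isEmpty_of_root_eq_none h).elim e
  | some r => exact (T.bicolored e r).symm

/-- Insert the point `none` into a permutation, as the predecessor of `a`
(as a fixed point if `a = none`). -/
noncomputable def insertNone {α : Type} (a : Option α) (π : Equiv.Perm α) :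
    Equiv.Perm (Option α) :=
  open Classical in Equiv.swap none a * Equiv.optionCongr π

theorem insertNone_none {α : Type} (a : Option α) (π : Equiv.Perm α) :
    insertNone a π none = a := by
  simp [insertNone]

theorem sameCycle_insertNone_some {α : Type} [Finite α] {a : Option α} {π : Equiv.Perm α}
    {x y : α} : (insertNone a π).SameCycle (some x) (some y) ↔ π.SameCycle x y := by
  classical
  unfold insertNone
  rw [Equiv.Perm.sameCycle_swap_mul_iff (by simp) (by simp) (by simp),
    Equiv.Perm.sameCycle_map_iff (π := π) (Option.some_injective _) (by simp)]

theorem sameCycle_insertNone_none {α : Type} [Finite α] {a : Option α} {π : Equiv.Perm α}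
    {y : α} : (insertNone a π).SameCycle none (some y) ↔ ∃ x, a = some x ∧ π.SameCycle x y := by
  rw [← Equiv.Perm.sameCycle_apply_left, insertNone_none]
  cases a with
  | none =>
    simp only [reduceCtorEq, false_and, exists_false, iff_false]
    intro h
    have := h.eq_of_left (insertNone_none _ _)
    simp at this
  | some x => simp [sameCycle_insertNone_some]

section Join

variable (w : ℕ+) (L R : RootedWeightedTree)

/-- The black end of an edge of `join w L R`. -/
noncomputable def joinBlack : Option (L.Edge ⊕ R.Edge) → L.Vertex ⊕ R.Vertex
  | none => .inl L.rootBlack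
  | some (.inl x) => .inl (L.blackEnd x)
  | some (.inr x) => .inr (R.blackEnd x)

/-- The white end of an edge of `join w L R`. -/
noncomputable def joinWhite : Option (L.Edge ⊕ R.Edge) → L.Vertex ⊕ R.Vertex
  | none => .inr R.rootWhite
  | some (.inl x) => .inl (L.whiteEnd x)
  | some (.inr x) => .inr (R.whiteEnd x)

theorem joinBlack_ne_joinWhite : ∀ e e', joinBlack L R e ≠ joinWhite L R e' := by
  rintro (_ | x | x) (_ | y | y) <;>
    simp [joinBlack, joinWhite, rootBlack_ne_whiteEnd, (rootWhite_ne_blackEnd _ _).symm,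
      L.bicolored, R.bicolored]

theorem join_simple : ∀ e e', joinBlack L R e = joinBlack L R e' →
    joinWhite L R e = joinWhite L R e' → e = e' := by
  rintro (_ | x | x) (_ | y | y) <;> simp [joinBlack, joinWhite]
  · exact L.simple x y
  · exact R.simple x y

theorem join_isTree : (endsGraph (joinBlack L R) (joinWhite L R)).IsTree := by
  set G := endsGraph (joinBlack L R) (joinWhite L R)
  have hadj := fun {u v} => endsGraph_adj (joinBlack_ne_joinWhite L R) (u := u) (v := v)
  rw [SimpleGraph.isTree_iff_connected_and_card]
  constructor
  · let fL : L.graph →g G := ⟨Sum.inl, fun {u v} h => by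
      obtain ⟨e, ⟨rfl, rfl⟩ | ⟨rfl, rfl⟩⟩ := (endsGraph_adj L.bicolored).1 h
      exacts [hadj.2 ⟨some (.inl e), .inl ⟨rfl, rfl⟩⟩, hadj.2 ⟨some (.inl e), .inr ⟨rfl, rfl⟩⟩]⟩
    let fR : R.graph →g G := ⟨Sum.inr, fun {u v} h => by
      obtain ⟨e, ⟨rfl, rfl⟩ | ⟨rfl, rfl⟩⟩ := (endsGraph_adj R.bicolored).1 h
      exacts [hadj.2 ⟨some (.inr e), .inl ⟨rfl, rfl⟩⟩, hadj.2 ⟨some (.inr e), .inr ⟨rfl, rfl⟩⟩]⟩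
    rw [SimpleGraph.connected_iff_exists_forall_reachable]
    refine ⟨.inl L.rootBlack, ?_⟩
    rintro (v | v)
    · exact (L.graph_isTree.1 L.rootBlack v).map fL
    · have h : G.Adj (.inl L.rootBlack) (.inr R.rootWhite) := hadj.2 ⟨none, .inl ⟨rfl, rfl⟩⟩
      exact h.reachable.trans ((R.graph_isTree.1 R.rootWhite v).map fR)
  · rw [card_edgeSet_endsGraph (joinBlack_ne_joinWhite L R) (join_simple L R),
      Finite.card_option, Nat.card_sum, Nat.card_sum, ← L.card_edge_add_one,
      ← R.card_edge_add_one]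
    ring

theorem sameCycle_sumCongr_inl {α β : Type} {π : Equiv.Perm α} {ρ : Equiv.Perm β} {x y : α} :
    (Equiv.Perm.sumCongr π ρ).SameCycle (.inl x) (.inl y) ↔ π.SameCycle x y :=
  Equiv.Perm.sameCycle_map_iff Sum.inl_injective (by simp)

theorem sameCycle_sumCongr_inr {α β : Type} {π : Equiv.Perm α} {ρ : Equiv.Perm β} {x y : β} :
    (Equiv.Perm.sumCongr π ρ).SameCycle (.inr x) (.inr y) ↔ ρ.SameCycle x y :=
  Equiv.Perm.sameCycle_map_iff Sum.inr_injective (by simp)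

theorem not_sameCycle_sumCongr {α β : Type} [Finite α] [Finite β] {π : Equiv.Perm α}
    {ρ : Equiv.Perm β} {x : α} {y : β} :
    ¬ (Equiv.Perm.sumCongr π ρ).SameCycle (.inl x) (.inr y) := by
  intro h
  have := h.induction_on (P := fun z => z.isLeft) (by rintro (z | z) <;> simp) rfl
  simp at this

/-- The permutation around the black vertices of `join w L R`: the new edge precedes the root of
`L`. -/
noncomputable def joinNextBlack : Equiv.Perm (Option (L.Edge ⊕ R.Edge)) :=
  insertNone (L.root.map .inl) (Equiv.Perm.sumCongr L.nextAtBlack R.nextAtBlack)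

/-- The permutation around the white vertices of `join w L R`: the new edge precedes the root of
`R`. -/
noncomputable def joinNextWhite : Equiv.Perm (Option (L.Edge ⊕ R.Edge)) :=
  insertNone (R.root.map .inr) (Equiv.Perm.sumCongr L.nextAtWhite R.nextAtWhite)

theorem joinNextBlack_sameCycle : ∀ e e', (joinNextBlack L R).SameCycle e e' ↔
    joinBlack L R e = joinBlack L R e' := by
  have key : ∀ z, (joinNextBlack L R).SameCycle none (some z) ↔
      joinBlack L R none = joinBlack L R (some z) := by
    intro z
    unfold joinNextBlack
    rw [sameCycle_insertNone_none]
    cases h : L.root with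
    | none =>
      rcases z with z | z
      · exact (L.isEmpty_of_root_eq_none h).elim z
      · simp [joinBlack]
    | some r =>
      rcases z with z | z
      · simp [joinBlack, rootBlack, h, sameCycle_sumCongr_inl, L.sameCycle_black]
      · simp [joinBlack, not_sameCycle_sumCongr]
  rintro (_ | x) (_ | y)
  · exact iff_of_true .rfl rfl
  · exact key y
  · rw [Equiv.Perm.sameCycle_comm, key, eq_comm]
  · unfold joinNextBlack
    rw [sameCycle_insertNone_some]
    rcases x with x | x <;> rcases y with y | y
    · simp [joinBlack, sameCycle_sumCongr_inl, L.sameCycle_black]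
    · simp [joinBlack, not_sameCycle_sumCongr]
    · rw [Equiv.Perm.sameCycle_comm]
      simp [joinBlack, not_sameCycle_sumCongr]
    · simp [joinBlack, sameCycle_sumCongr_inr, R.sameCycle_black]

theorem joinNextWhite_sameCycle : ∀ e e', (joinNextWhite L R).SameCycle e e' ↔
    joinWhite L R e = joinWhite L R e' := by
  have key : ∀ z, (joinNextWhite L R).SameCycle none (some z) ↔
      joinWhite L R none = joinWhite L R (some z) := by
    intro z
    unfold joinNextWhite
    rw [sameCycle_insertNone_none]
    cases h : R.root with
    | none =>
      rcases z with z | z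
      · simp [joinWhite]
      · exact (R.isEmpty_of_root_eq_none h).elim z
    | some r =>
      rcases z with z | z
      · simp only [Option.map_some, Option.some.injEq, exists_eq_left', joinWhite, reduceCtorEq,
          iff_false]
        rw [Equiv.Perm.sameCycle_comm]
        exact not_sameCycle_sumCongr
      · simp [joinWhite, rootWhite, h, sameCycle_sumCongr_inr, R.sameCycle_white]
  rintro (_ | x) (_ | y)
  · exact iff_of_true .rfl rfl
  · exact key y
  · rw [Equiv.Perm.sameCycle_comm, key, eq_comm]
  · unfold joinNextWhite
    rw [sameCycle_insertNone_some]
    rcases x with x | x <;> rcases y with y | y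
    · simp [joinWhite, sameCycle_sumCongr_inl, L.sameCycle_white]
    · simp [joinWhite, not_sameCycle_sumCongr]
    · rw [Equiv.Perm.sameCycle_comm]
      simp [joinWhite, not_sameCycle_sumCongr]
    · simp [joinWhite, sameCycle_sumCongr_inr, R.sameCycle_white]

/-- The rooted tree obtained from `L` and `R` by adding a root edge of weight `w`, encoded as
`none`: its black end is attached to `L`, just before the root of `L`, and its white end to `R`,
just before the root of `R`. -/
noncomputable def join : RootedWeightedTree where
  Vertex := L.Vertex ⊕ R.Vertex
  Edge := Option (L.Edge ⊕ R.Edge)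
  finite_vertex := inferInstance
  finite_edge := inferInstance
  blackEnd := joinBlack L R
  whiteEnd := joinWhite L R
  bicolored := joinBlack_ne_joinWhite L R
  simple := join_simple L R
  isTree := join_isTree L R
  nextAtBlack := joinNextBlack L R
  nextAtWhite := joinNextWhite L R
  sameCycle_black := joinNextBlack_sameCycle L R
  sameCycle_white := joinNextWhite_sameCycle L R
  weight := fun e => e.elim w (Sum.elim L.weight R.weight)
  root := some none
  isEmpty_of_root_eq_none := by simp

theorem join_totalWeight :
    (join w L R).totalWeight = w + L.totalWeight + R.totalWeight := by
  have := Fintype.ofFinite L.Edge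
  have := Fintype.ofFinite R.Edge
  change ∑ᶠ e : Option (L.Edge ⊕ R.Edge), ((join w L R).weight e : ℕ) = _
  rw [totalWeight, totalWeight, finsum_eq_sum_of_fintype, finsum_eq_sum_of_fintype,
    finsum_eq_sum_of_fintype, Fintype.sum_option, Fintype.sum_sum_type, add_assoc]
  rfl

theorem join_numEdges : (join w L R).numEdges = L.numEdges + R.numEdges + 1 := by
  change Nat.card (Option (L.Edge ⊕ R.Edge)) = _
  rw [Finite.card_option, Nat.card_sum]
  rfl

end Join

/-- Insertion of a point is natural: a map that commutes with two permutations commutes with their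
enlargements. -/
theorem insertNone_map {α β : Type} {a : Option α} {π : Equiv.Perm α} {ρ : Equiv.Perm β}
    (f : α ≃ β) (h : ∀ x, ρ (f x) = f (π x)) (x : Option α) :
    insertNone (a.map f) ρ (f.optionCongr x) = f.optionCongr (insertNone a π x) := by
  classical
  simp only [insertNone, Equiv.Perm.mul_apply]
  rw [← f.optionCongr.injective.swap_apply]
  congr 1
  cases x <;> simp [h]

theorem join_congr {w : ℕ+} {L L' R R' : RootedWeightedTree} (hL : L ≈ L') (hR : R ≈ R') :
    join w L R ≈ join w L' R' := by
  obtain ⟨f, hf⟩ := hL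
  obtain ⟨g, hg⟩ := hR
  refine equiv_of_edge (T := join w L R) (T' := join w L' R')
    (Equiv.optionCongr (Equiv.sumCongr f.edge g.edge)) ?_ ?_ ?_ rfl
  · intro e
    have hr : L'.root.map .inl = (L.root.map .inl).map (Equiv.sumCongr f.edge g.edge) := by
      rw [← hf]
      cases L.root <;> rfl
    have := insertNone_map (a := L.root.map .inl)
      (π := Equiv.Perm.sumCongr L.nextAtBlack R.nextAtBlack)
      (ρ := Equiv.Perm.sumCongr L'.nextAtBlack R'.nextAtBlack) (Equiv.sumCongr f.edge g.edge)
      (by rintro (x | x) <;> simp [f.map_nextAtBlack, g.map_nextAtBlack]) e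
    rwa [← hr] at this
  · intro e
    have hr : R'.root.map .inr = (R.root.map .inr).map (Equiv.sumCongr f.edge g.edge) := by
      rw [← hg]
      cases R.root <;> rfl
    have := insertNone_map (a := R.root.map .inr)
      (π := Equiv.Perm.sumCongr L.nextAtWhite R.nextAtWhite)
      (ρ := Equiv.Perm.sumCongr L'.nextAtWhite R'.nextAtWhite) (Equiv.sumCongr f.edge g.edge)
      (by rintro (x | x) <;> simp [f.map_nextAtWhite, g.map_nextAtWhite]) e
    rwa [← hr] at this
  · rintro (_ | x | x)
    · rfl
    · exact f.map_weight x
    · exact g.map_weight x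

/-! ### The parts of a join are determined by the join -/

/-- An equivalence that carries the inserted point to the inserted point and commutes with the
enlarged permutations commutes with the original ones. -/
theorem optionCongr_map {α β : Type} {a : Option α} {b : Option β} {π : Equiv.Perm α}
    {ρ : Equiv.Perm β} (f : Option α ≃ Option β) (h0 : f none = none)
    (h : ∀ x, insertNone b ρ (f x) = f (insertNone a π x)) :
    f a = b ∧ ∀ x, Equiv.optionCongr ρ (f x) = f (Equiv.optionCongr π x) := by
  classical
  have hab : f a = b := by
    have := h none
    rwa [h0, insertNone_none, insertNone_none, eq_comm] at this
  refine ⟨hab, fun x => ?_⟩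
  have := h x
  simp only [insertNone, Equiv.Perm.mul_apply] at this
  rw [← f.injective.swap_apply, h0, hab] at this
  exact (Equiv.swap none b).injective this

section JoinInj

variable {w w' : ℕ+} {L L' R R' : RootedWeightedTree}

theorem join_inj_aux
    (f : Option (L.Edge ⊕ R.Edge) ≃ Option (L'.Edge ⊕ R'.Edge)) (h0 : f none = none)
    (hb : ∀ e, joinNextBlack L' R' (f e) = f (joinNextBlack L R e))
    (hw : ∀ e, joinNextWhite L' R' (f e) = f (joinNextWhite L R e)) :
    (∀ x, ∃ y, f (some (.inl x)) = some (.inl y)) ∧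
      ∀ x, ∃ y, f (some (.inr x)) = some (.inr y) := by
  obtain ⟨hbr, hb⟩ := optionCongr_map f h0 hb
  obtain ⟨hwr, hw⟩ := optionCongr_map f h0 hw
  constructor
  · intro x
    cases hr : L.root with
    | none => exact (L.isEmpty_of_root_eq_none hr).elim x
    | some r =>
      refine edge_induction (P := fun x => ∃ y, f (some (.inl x)) = some (.inl y)) (e₀ := r)
        ?_ ?_ ?_ x
      · rintro e ⟨y, hy⟩
        exact ⟨L'.nextAtBlack y, by simpa [hy] using (hb (some (.inl e))).symm⟩
      · rintro e ⟨y, hy⟩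
        exact ⟨L'.nextAtWhite y, by simpa [hy] using (hw (some (.inl e))).symm⟩
      · rw [hr] at hbr
        cases hr' : L'.root with
        | none =>
          rw [hr', Option.map_none, ← h0] at hbr
          simpa using f.injective hbr
        | some r' => exact ⟨r', by simpa [hr'] using hbr⟩
  · intro x
    cases hr : R.root with
    | none => exact (R.isEmpty_of_root_eq_none hr).elim x
    | some r =>
      refine edge_induction (P := fun x => ∃ y, f (some (.inr x)) = some (.inr y)) (e₀ := r)
        ?_ ?_ ?_ x
      · rintro e ⟨y, hy⟩
        exact ⟨R'.nextAtBlack y, by simpa [hy] using (hb (some (.inr e))).symm⟩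
      · rintro e ⟨y, hy⟩
        exact ⟨R'.nextAtWhite y, by simpa [hy] using (hw (some (.inr e))).symm⟩
      · rw [hr] at hwr
        cases hr' : R'.root with
        | none =>
          rw [hr', Option.map_none, ← h0] at hwr
          simpa using f.injective hwr
        | some r' => exact ⟨r', by simpa [hr'] using hwr⟩

/-- An equivalence whose forward and backward maps restrict along injections restricts to an
equivalence. -/
theorem exists_equiv_restrict {α β α' β' : Type} (f : α' ≃ β') {i : α → α'} {j : β → β'}
    (hi : Function.Injective i) (hj : Function.Injective j) (h : ∀ x, ∃ y, f (i x) = j y)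
    (h' : ∀ y, ∃ x, f.symm (j y) = i x) : ∃ g : α ≃ β, ∀ x, f (i x) = j (g x) := by
  choose g hg using h
  choose k hk using h'
  refine ⟨⟨g, k, fun x => hi ?_, fun y => hj ?_⟩, hg⟩
  · rw [← hk, ← hg, f.symm_apply_apply]
  · rw [← hg, ← hk, f.apply_symm_apply]

theorem join_inj (h : join w L R ≈ join w' L' R') : w = w' ∧ L ≈ L' ∧ R ≈ R' := by
  obtain ⟨F, hF⟩ := h
  let f : Option (L.Edge ⊕ R.Edge) ≃ Option (L'.Edge ⊕ R'.Edge) := F.edge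
  have h0 : f none = none := Option.some_injective _ hF
  have hb : ∀ e, joinNextBlack L' R' (f e) = f (joinNextBlack L R e) := F.map_nextAtBlack
  have hw : ∀ e, joinNextWhite L' R' (f e) = f (joinNextWhite L R e) := F.map_nextAtWhite
  have hwt : ∀ e, (join w' L' R').weight (f e) = (join w L R).weight e := F.map_weight
  obtain ⟨hl, hr⟩ := join_inj_aux f h0 hb hw
  obtain ⟨hl', hr'⟩ := join_inj_aux f.symm (by rw [Equiv.symm_apply_eq, h0])
    (fun e => by rw [Equiv.eq_symm_apply, ← hb, Equiv.apply_symm_apply])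
    (fun e => by rw [Equiv.eq_symm_apply, ← hw, Equiv.apply_symm_apply])
  obtain ⟨hbr, hb⟩ := optionCongr_map f h0 hb
  obtain ⟨hwr, hw⟩ := optionCongr_map f h0 hw
  refine ⟨?_, ?_, ?_⟩
  · have := hwt none
    rw [h0] at this
    exact this.symm
  · have hinj : ∀ (A B : Type), Function.Injective (fun x : A => some (Sum.inl (β := B) x)) :=
      fun A B => (Option.some_injective _).comp Sum.inl_injective
    obtain ⟨g, hg⟩ := exists_equiv_restrict f (hinj L.Edge R.Edge) (hinj _ _) hl hl'
    refine equiv_of_edge g (fun e => hinj _ R'.Edge ?_) (fun e => hinj _ R'.Edge ?_)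
      (fun e => ?_) ?_
    · simpa [hg] using hb (some (.inl e))
    · simpa [hg] using hw (some (.inl e))
    · have := hwt (some (.inl e))
      rw [hg] at this
      exact this
    · apply Option.map_injective (Sum.inl_injective (β := R'.Edge))
      rw [← hbr]
      cases L.root with
      | none => simp [h0]
      | some r => simp [hg]
  · have hinj : ∀ (A B : Type), Function.Injective (fun x : A => some (Sum.inr (α := B) x)) :=
      fun A B => (Option.some_injective _).comp Sum.inr_injective
    obtain ⟨g, hg⟩ := exists_equiv_restrict f (hinj R.Edge L.Edge) (hinj _ _) hr hr'
    refine equiv_of_edge g (fun e => hinj _ L'.Edge ?_) (fun e => hinj _ L'.Edge ?_)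
      (fun e => ?_) ?_
    · simpa [hg] using hb (some (.inr e))
    · simpa [hg] using hw (some (.inr e))
    · have := hwt (some (.inr e))
      rw [hg] at this
      exact this
    · apply Option.map_injective (Sum.inr_injective (α := L'.Edge))
      rw [← hwr]
      cases R.root with
      | none => simp [h0]
      | some r => simp [hg]

end JoinInj

/-! ### Encoding by binary trees -/

/-- The tree without edges. -/
def single : RootedWeightedTree where
  Vertex := Unit
  Edge := Empty
  finite_vertex := inferInstance
  finite_edge := inferInstance
  blackEnd := Empty.elim
  whiteEnd := Empty.elim
  bicolored := fun e => e.elim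
  simple := fun e => e.elim
  isTree := .of_subsingleton
  nextAtBlack := 1
  nextAtWhite := 1
  sameCycle_black := fun e => e.elim
  sameCycle_white := fun e => e.elim
  weight := Empty.elim
  root := none
  isEmpty_of_root_eq_none := fun _ => inferInstance

/-- The rooted weighted tree described by a binary tree with node labels in `ℕ+`: each node is an
edge, labelled by its weight. -/
noncomputable def ofBinaryTree : BinaryTree ℕ+ → RootedWeightedTree
  | .nil => single
  | .node w l r => join w (ofBinaryTree l) (ofBinaryTree r)

end RootedWeightedTree

/-- The sum of the labels of a binary tree. -/
def BinaryTree.weight : BinaryTree ℕ+ → ℕ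
  | .nil => 0
  | .node w l r => w + l.weight + r.weight

namespace RootedWeightedTree

theorem ofBinaryTree_totalWeight (t : BinaryTree ℕ+) :
    (ofBinaryTree t).totalWeight = t.weight := by
  induction t with
  | nil => exact finsum_of_isEmpty (α := Empty) _
  | node w l r hl hr => rw [ofBinaryTree, join_totalWeight, hl, hr, BinaryTree.weight]

theorem ofBinaryTree_numEdges (t : BinaryTree ℕ+) :
    (ofBinaryTree t).numEdges = t.numNodes := by
  induction t with
  | nil => exact Nat.card_of_isEmpty (α := Empty)
  | node w l r hl hr => rw [ofBinaryTree, join_numEdges, hl, hr, BinaryTree.numNodes]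

theorem ofBinaryTree_injective {s t : BinaryTree ℕ+} (h : ofBinaryTree s ≈ ofBinaryTree t) :
    s = t := by
  induction s generalizing t with
  | nil =>
    cases t with
    | nil => rfl
    | node w l r =>
      obtain ⟨f, hf⟩ := h
      exact absurd hf (by simp [ofBinaryTree, single, join])
  | node w l r hl hr =>
    cases t with
    | nil =>
      obtain ⟨f, hf⟩ := h
      exact absurd hf (by simp [ofBinaryTree, single, join])
    | node w' l' r' =>
      obtain ⟨rfl, h1, h2⟩ := join_inj h
      rw [hl h1, hr h2]

end RootedWeightedTree

/-! ### Cutting a tree at an edge -/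

namespace WeightedTree

variable (T : WeightedTree) (e : T.Edge)

/-- The underlying graph of `T` with the edge `e` deleted. -/
abbrev cutGraph : SimpleGraph T.Vertex :=
  endsGraph (fun x : {x // x ≠ e} => T.blackEnd x) (fun x => T.whiteEnd x)

theorem cutGraph_adj {u v : T.Vertex} : (T.cutGraph e).Adj u v ↔
    ∃ x, x ≠ e ∧ ((T.blackEnd x = u ∧ T.whiteEnd x = v) ∨
      (T.blackEnd x = v ∧ T.whiteEnd x = u)) := by
  rw [endsGraph_adj (fun _ _ => T.bicolored _ _)]
  simp

theorem cutGraph_isAcyclic : (T.cutGraph e).IsAcyclic := by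
  refine T.graph_isTree.2.anti fun u v h => ?_
  obtain ⟨x, -, h⟩ := (T.cutGraph_adj e).1 h
  exact (endsGraph_adj T.bicolored).2 ⟨x, h⟩

variable {T e}

theorem cutGraph_reachable_ends {x : T.Edge} (hx : x ≠ e) :
    (T.cutGraph e).Reachable (T.blackEnd x) (T.whiteEnd x) :=
  SimpleGraph.Adj.reachable ((T.cutGraph_adj e).2 ⟨x, hx, .inl ⟨rfl, rfl⟩⟩)

theorem cutGraph_reachable_iff {x : T.Edge} (hx : x ≠ e) {v : T.Vertex} :
    (T.cutGraph e).Reachable v (T.blackEnd x) ↔ (T.cutGraph e).Reachable v (T.whiteEnd x) :=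
  ⟨fun h => h.trans (cutGraph_reachable_ends hx),
    fun h => h.trans (cutGraph_reachable_ends hx).symm⟩

/-- Every edge of a tree is a bridge. -/
theorem not_cutGraph_reachable : ¬ (T.cutGraph e).Reachable (T.blackEnd e) (T.whiteEnd e) := by
  have h := (SimpleGraph.isAcyclic_iff_forall_isBridge.1 T.graph_isTree.2)
    (T.graph.mem_edgeSet.2 (endsGraph_adj_ends T.bicolored e))
  rw [SimpleGraph.isBridge_iff] at h
  intro hr
  refine h (hr.mono fun u v huv => ?_)
  obtain ⟨x, hx, hxe⟩ := (T.cutGraph_adj e).1 huv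
  rw [SimpleGraph.deleteEdges_adj]
  refine ⟨(endsGraph_adj T.bicolored).2 ⟨x, hxe⟩, fun hs => hx ?_⟩
  rw [Set.mem_singleton_iff, Sym2.eq_iff] at hs
  rcases hxe with ⟨rfl, rfl⟩ | ⟨rfl, rfl⟩ <;> rcases hs with ⟨h1, h2⟩ | ⟨h1, h2⟩
  · exact T.simple _ _ h1 h2
  · exact absurd h1 (T.bicolored _ _)
  · exact absurd h2 (T.bicolored _ _)
  · exact T.simple _ _ h2 h1

theorem cutGraph_cover (v : T.Vertex) : (T.cutGraph e).Reachable (T.blackEnd e) v ∨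
    (T.cutGraph e).Reachable (T.whiteEnd e) v := by
  refine vertex_induction (Q := fun v => (T.cutGraph e).Reachable (T.blackEnd e) v ∨
    (T.cutGraph e).Reachable (T.whiteEnd e) v) (fun x => ?_) (u := T.blackEnd e) (.inl .rfl) v
  by_cases hx : x = e
  · subst hx
    exact iff_of_true (.inl .rfl) (.inr .rfl)
  · rw [cutGraph_reachable_iff hx, cutGraph_reachable_iff hx]

/-- The permutation `π` with the point `e` removed from its cycle and made a fixed point. -/
noncomputable def bypass {α : Type} (π : Equiv.Perm α) (e : α) : Equiv.Perm α :=
  open Classical in Equiv.swap e (π e) * π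

theorem bypass_self {α : Type} (π : Equiv.Perm α) (e : α) : bypass π e e = e := by
  simp [bypass]

theorem bypass_ne_iff {α : Type} (π : Equiv.Perm α) {e x : α} : bypass π e x ≠ e ↔ x ≠ e := by
  rw [← (bypass π e).injective.ne_iff (x := x), bypass_self]

theorem swap_bypass {α : Type} [DecidableEq α] (π : Equiv.Perm α) (e x : α) :
    Equiv.swap e (π e) (bypass π e x) = π x := by
  have h : bypass π e x = Equiv.swap e (π e) (π x) := by
    rw [bypass, Equiv.Perm.mul_apply]
    congr!
  rw [h]
  exact Equiv.congr_fun (Equiv.swap_swap e (π e)) (π x)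

theorem sameCycle_bypass {α : Type} [Finite α] (π : Equiv.Perm α) {e x y : α} (hx : x ≠ e)
    (hy : y ≠ e) : (bypass π e).SameCycle x y ↔ π.SameCycle x y := by
  classical
  rw [← Equiv.Perm.sameCycle_swap_mul_iff (a := π e) (bypass_self π e) hx hy]
  congr! 1
  ext z
  exact swap_bypass π e z

theorem blackEnd_next (x : T.Edge) : T.blackEnd (T.nextAtBlack x) = T.blackEnd x := by
  rw [← T.sameCycle_black, Equiv.Perm.sameCycle_apply_left]

theorem whiteEnd_next (x : T.Edge) : T.whiteEnd (T.nextAtWhite x) = T.whiteEnd x := by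
  rw [← T.sameCycle_white, Equiv.Perm.sameCycle_apply_left]

theorem blackEnd_bypass (x : T.Edge) :
    T.blackEnd (bypass T.nextAtBlack e x) = T.blackEnd x := by
  classical
  rw [← blackEnd_next x, ← swap_bypass T.nextAtBlack e x,
    Equiv.apply_swap_eq_self (blackEnd_next e).symm]

theorem whiteEnd_bypass (x : T.Edge) :
    T.whiteEnd (bypass T.nextAtWhite e x) = T.whiteEnd x := by
  classical
  rw [← whiteEnd_next x, ← swap_bypass T.nextAtWhite e x,
    Equiv.apply_swap_eq_self (whiteEnd_next e).symm]

variable (T e)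

/-- The edges of the component of `v` after deletion of the edge `e`. -/
abbrev ComponentEdge (v : T.Vertex) : Type :=
  {x : T.Edge // x ≠ e ∧ (T.cutGraph e).Reachable v (T.blackEnd x)}

theorem component_isTree (v : T.Vertex) :
    (endsGraph (V := {u // (T.cutGraph e).Reachable v u})
      (fun x : T.ComponentEdge e v => ⟨T.blackEnd x, x.2.2⟩)
      (fun x => ⟨T.whiteEnd x, (cutGraph_reachable_iff x.2.1).1 x.2.2⟩)).IsTree := by
  set G := endsGraph (V := {u // (T.cutGraph e).Reachable v u})
      (fun x : T.ComponentEdge e v => ⟨T.blackEnd x, x.2.2⟩)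
      (fun x => ⟨T.whiteEnd x, (cutGraph_reachable_iff x.2.1).1 x.2.2⟩)
  have hadj : ∀ a b, G.Adj a b ↔ (T.cutGraph e).Adj a b := by
    intro a b
    rw [endsGraph_adj (fun _ _ h => T.bicolored _ _ (congrArg Subtype.val h)), cutGraph_adj]
    constructor
    · rintro ⟨x, h⟩
      exact ⟨x, x.2.1, h.imp (fun h => ⟨congrArg Subtype.val h.1, congrArg Subtype.val h.2⟩)
        (fun h => ⟨congrArg Subtype.val h.1, congrArg Subtype.val h.2⟩)⟩
    · rintro ⟨x, hx, h⟩
      have hr : (T.cutGraph e).Reachable v (T.blackEnd x) := by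
        rcases h with ⟨h1, -⟩ | ⟨h1, -⟩
        exacts [h1 ▸ a.2, h1 ▸ b.2]
      exact ⟨⟨x, hx, hr⟩, h.imp (fun h => ⟨Subtype.ext h.1, Subtype.ext h.2⟩)
        (fun h => ⟨Subtype.ext h.1, Subtype.ext h.2⟩)⟩
  constructor
  · rw [SimpleGraph.connected_iff_exists_forall_reachable]
    refine ⟨⟨v, .rfl⟩, ?_⟩
    have key : ∀ {a b : T.Vertex} (p : (T.cutGraph e).Walk a b)
        (ha : (T.cutGraph e).Reachable v a) (hb : (T.cutGraph e).Reachable v b),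
        G.Reachable ⟨a, ha⟩ ⟨b, hb⟩ := by
      intro a b p
      induction p with
      | nil => exact fun _ _ => .rfl
      | cons h _ ih =>
        intro ha hb
        have hc := ha.trans h.reachable
        exact ((hadj ⟨_, ha⟩ ⟨_, hc⟩).2 h).reachable.trans (ih hc hb)
    rintro ⟨u, ⟨p⟩⟩
    exact key p _ _
  · exact (T.cutGraph_isAcyclic e).comap ⟨Subtype.val, fun {a b} h => (hadj a b).1 h⟩
      Subtype.val_injective

/-- The component of the vertex `v` after deletion of the edge `e`, as a tree: the cyclic orders
are those of `T` with `e` skipped. -/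
noncomputable def component (v : T.Vertex) : WeightedTree where
  Vertex := {u // (T.cutGraph e).Reachable v u}
  Edge := T.ComponentEdge e v
  finite_vertex := inferInstance
  finite_edge := inferInstance
  blackEnd := fun x => ⟨T.blackEnd x, x.2.2⟩
  whiteEnd := fun x => ⟨T.whiteEnd x, (cutGraph_reachable_iff x.2.1).1 x.2.2⟩
  bicolored := fun _ _ h => T.bicolored _ _ (congrArg Subtype.val h)
  simple := fun _ _ h h' =>
    Subtype.ext (T.simple _ _ (congrArg Subtype.val h) (congrArg Subtype.val h'))
  isTree := T.component_isTree e v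
  nextAtBlack := (bypass T.nextAtBlack e).subtypePerm fun x => by
    rw [bypass_ne_iff, blackEnd_bypass]
  nextAtWhite := (bypass T.nextAtWhite e).subtypePerm fun x => by
    rw [bypass_ne_iff]
    refine and_congr_right fun hx => ?_
    rw [cutGraph_reachable_iff hx, cutGraph_reachable_iff ((bypass_ne_iff _).2 hx),
      whiteEnd_bypass]
  sameCycle_black := fun x y => by
    rw [Equiv.Perm.sameCycle_subtypePerm, sameCycle_bypass _ x.2.1 y.2.1, T.sameCycle_black,
      Subtype.mk.injEq]
  sameCycle_white := fun x y => by
    rw [Equiv.Perm.sameCycle_subtypePerm, sameCycle_bypass _ x.2.1 y.2.1, T.sameCycle_white,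
      Subtype.mk.injEq]
  weight := fun x => T.weight x

theorem component_numEdges_lt (v : T.Vertex) : (T.component e v).numEdges < T.numEdges :=
  Finite.card_subtype_lt (x := e) (by simp)

/-- A vertex without edges other than `e` is a whole component after deletion of `e`. -/
theorem isEmpty_componentEdge {v : T.Vertex}
    (hv : ∀ x, x ≠ e → T.blackEnd x ≠ v ∧ T.whiteEnd x ≠ v) :
    IsEmpty (T.ComponentEdge e v) := by
  refine ⟨fun ⟨x, hx, hr⟩ => ?_⟩
  have h : v = T.blackEnd x := by
    refine endsGraph_reachable_induction (fun _ _ => T.bicolored _ _) (Q := fun u => v = u)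
      (fun y => iff_of_false ?_ ?_) hr rfl
    · exact fun h => (hv y y.2).1 h.symm
    · exact fun h => (hv y y.2).2 h.symm
  exact (hv x hx).1 h.symm

open Classical in
/-- The successor of `e` around its black end, if there is another edge. -/
noncomputable def blackRoot : Option (T.ComponentEdge e (T.blackEnd e)) :=
  if h : T.nextAtBlack e = e then none
  else some ⟨T.nextAtBlack e, h, by rw [blackEnd_next]⟩

theorem blackRoot_eq_none : T.blackRoot e = none ↔ T.nextAtBlack e = e := by
  unfold blackRoot
  split_ifs with h <;> simp [h]

/-- The component at the black end of `e`, rooted at the successor of `e` around this end. -/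
noncomputable def blackPart : RootedWeightedTree where
  toWeightedTree := T.component e (T.blackEnd e)
  root := T.blackRoot e
  isEmpty_of_root_eq_none := fun hr => by
    have h := (T.blackRoot_eq_none e).1 hr
    refine T.isEmpty_componentEdge e fun x hx => ⟨fun hb => hx ?_, (T.bicolored _ _).symm⟩
    exact (((T.sameCycle_black _ _).2 hb.symm).eq_of_left h).symm

open Classical in
/-- The successor of `e` around its white end, if there is another edge. -/
noncomputable def whiteRoot : Option (T.ComponentEdge e (T.whiteEnd e)) :=
  if h : T.nextAtWhite e = e then none
  else some ⟨T.nextAtWhite e, h, (cutGraph_reachable_iff h).2 (by rw [whiteEnd_next])⟩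

theorem whiteRoot_eq_none : T.whiteRoot e = none ↔ T.nextAtWhite e = e := by
  unfold whiteRoot
  split_ifs with h <;> simp [h]

/-- The component at the white end of `e`, rooted at the successor of `e` around this end. -/
noncomputable def whitePart : RootedWeightedTree where
  toWeightedTree := T.component e (T.whiteEnd e)
  root := T.whiteRoot e
  isEmpty_of_root_eq_none := fun hr => by
    have h := (T.whiteRoot_eq_none e).1 hr
    refine T.isEmpty_componentEdge e fun x hx => ⟨T.bicolored _ _, fun hb => hx ?_⟩
    exact (((T.sameCycle_white _ _).2 hb.symm).eq_of_left h).symm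

/-- The edges of the join of the two parts, as edges of `T`. -/
def partsEdge :
    Option (T.ComponentEdge e (T.blackEnd e) ⊕ T.ComponentEdge e (T.whiteEnd e)) → T.Edge
  | none => e
  | some (.inl x) => x
  | some (.inr x) => x

theorem partsEdge_blackRoot : T.partsEdge e ((T.blackRoot e).map .inl) = T.nextAtBlack e := by
  unfold blackRoot
  split_ifs with h
  · exact h.symm
  · rfl

theorem partsEdge_whiteRoot : T.partsEdge e ((T.whiteRoot e).map .inr) = T.nextAtWhite e := by
  unfold whiteRoot
  split_ifs with h
  · exact h.symm
  · rfl

theorem partsEdge_bijective : Function.Bijective (T.partsEdge e) := by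
  have hdisj : ∀ x, (T.cutGraph e).Reachable (T.blackEnd e) (T.blackEnd x) →
      ¬ (T.cutGraph e).Reachable (T.whiteEnd e) (T.blackEnd x) :=
    fun x h h' => not_cutGraph_reachable (h.trans h'.symm)
  constructor
  · rintro (_ | ⟨x, hx⟩ | ⟨x, hx⟩) (_ | ⟨y, hy⟩ | ⟨y, hy⟩) h <;> simp only [partsEdge] at h
    · rfl
    · exact absurd h.symm hy.1
    · exact absurd h.symm hy.1
    · exact absurd h hx.1
    · subst h; rfl
    · subst h; exact absurd hy.2 (hdisj _ hx.2)
    · exact absurd h hx.1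
    · subst h; exact absurd hx.2 (hdisj _ hy.2)
    · subst h; rfl
  · intro x
    by_cases hx : x = e
    · exact ⟨none, hx.symm⟩
    · rcases cutGraph_cover (e := e) (T.blackEnd x) with h | h
      exacts [⟨some (.inl ⟨x, hx, h⟩), rfl⟩, ⟨some (.inr ⟨x, hx, h⟩), rfl⟩]

end WeightedTree

namespace RootedWeightedTree

open WeightedTree

theorem map_insertNone {α β : Type} {e : β} {σ : Equiv.Perm β} {f : Option α → β}
    (hf : Function.Injective f) (h0 : f none = e) {a : Option α} (ha : f a = σ e)
    {π : Equiv.Perm α} (hπ : ∀ x, f (some (π x)) = bypass σ e (f (some x))) (x : Option α) :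
    f (insertNone a π x) = σ (f x) := by
  classical
  rw [← swap_bypass σ e, insertNone, Equiv.Perm.mul_apply, ← hf.swap_apply, h0, ha]
  congr 1
  cases x with
  | none => simp [h0, bypass_self]
  | some x => exact hπ x

/-- A rooted tree is the join of the two parts into which the deletion of its root cuts it. -/
theorem join_parts_equiv (T : RootedWeightedTree) {e : T.Edge} (he : T.root = some e) :
    join (T.weight e) (T.blackPart e) (T.whitePart e) ≈ T := by
  have hbij := T.partsEdge_bijective e
  refine equiv_of_edge (T := join (T.weight e) (T.blackPart e) (T.whitePart e))
    (Equiv.ofBijective (T.partsEdge e) hbij) ?_ ?_ ?_ he.symm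
  · intro x
    refine (map_insertNone hbij.1 rfl ?_ ?_ x).symm
    · exact T.partsEdge_blackRoot e
    · rintro (x | x) <;> rfl
  · intro x
    refine (map_insertNone hbij.1 rfl ?_ ?_ x).symm
    · exact T.partsEdge_whiteRoot e
    · rintro (x | x) <;> rfl
  · rintro (_ | x | x) <;> rfl

theorem exists_ofBinaryTree_equiv (T : RootedWeightedTree) :
    ∃ t : BinaryTree ℕ+, ofBinaryTree t ≈ T := by
  induction hn : T.numEdges using Nat.strong_induction_on generalizing T with
  | _ n ih =>
    subst hn
    cases hr : T.root with
    | none =>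
      have hE := T.isEmpty_of_root_eq_none hr
      have hE' : IsEmpty (ofBinaryTree .nil).Edge := inferInstanceAs (IsEmpty Empty)
      exact ⟨.nil, equiv_of_edge (Equiv.equivOfIsEmpty _ _) (fun x => isEmptyElim x)
        (fun x => isEmptyElim x) (fun x => isEmptyElim x) hr.symm⟩
    | some e =>
      obtain ⟨l, hl⟩ := ih _ (T.component_numEdges_lt e _) (T.blackPart e) rfl
      obtain ⟨r, hr'⟩ := ih _ (T.component_numEdges_lt e _) (T.whitePart e) rfl
      exact ⟨.node (T.weight e) l r,
        Setoid.trans (join_congr hl hr') (T.join_parts_equiv hr)⟩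

/-- Rooted weighted trees up to isomorphism are the same as binary trees with labels in `ℕ+`. -/
noncomputable def classEquiv : BinaryTree ℕ+ ≃ Quotient RootedWeightedTree.isoSetoid :=
  Equiv.ofBijective (fun t => ⟦ofBinaryTree t⟧) ⟨fun _ _ h => ofBinaryTree_injective
    (Quotient.exact h), fun q => q.inductionOn fun T => (exists_ofBinaryTree_equiv T).imp
      fun _ h => Quotient.sound h⟩

theorem classes_eq (n : ℕ) : classes n = classEquiv '' {t | t.weight = n} := by
  ext q
  constructor
  · rintro ⟨T, rfl, rfl⟩
    obtain ⟨t, ht⟩ := exists_ofBinaryTree_equiv T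
    refine ⟨t, ?_, Quotient.sound ht⟩
    obtain ⟨f, -⟩ := ht
    rw [Set.mem_ofPred_eq, ← ofBinaryTree_totalWeight, f.totalWeight_eq]
  · rintro ⟨t, rfl, rfl⟩
    exact ⟨_, rfl, ofBinaryTree_totalWeight t⟩

theorem classesWithEdges_eq (m n : ℕ) :
    classesWithEdges m n = classEquiv '' {t | t.weight = n ∧ t.numNodes = m} := by
  ext q
  constructor
  · rintro ⟨T, rfl, rfl, rfl⟩
    obtain ⟨t, ht⟩ := exists_ofBinaryTree_equiv T
    refine ⟨t, ?_, Quotient.sound ht⟩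
    obtain ⟨f, -⟩ := ht
    rw [Set.mem_ofPred_eq, ← ofBinaryTree_totalWeight, f.totalWeight_eq, ← ofBinaryTree_numEdges,
      f.numEdges_eq]
    exact ⟨rfl, rfl⟩
  · rintro ⟨t, ⟨rfl, rfl⟩, rfl⟩
    exact ⟨_, rfl, ofBinaryTree_totalWeight t, ofBinaryTree_numEdges t⟩

end RootedWeightedTree

theorem rootedCount_eq (n : ℕ) :
    rootedCount n = Nat.card {t : BinaryTree ℕ+ // t.weight = n} := by
  rw [rootedCount, RootedWeightedTree.classes_eq,
    Set.ncard_image_of_injective _ (Equiv.injective _)]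
  rfl

theorem rootedEdgeCount_eq (m n : ℕ) :
    rootedEdgeCount m n = Nat.card {t : BinaryTree ℕ+ // t.weight = n ∧ t.numNodes = m} := by
  rw [rootedEdgeCount, RootedWeightedTree.classesWithEdges_eq,
    Set.ncard_image_of_injective _ (Equiv.injective _)]
  rfl

/-! ### Weight enumerators -/

section Enumerator

variable {σ A B : Type}

/-- The generating function that counts the elements of `A` by the exponent `wt`. -/
noncomputable def enumerator (wt : A → σ →₀ ℕ) : MvPowerSeries σ ℚ :=
  fun d => (Nat.card {a // wt a = d} : ℚ)

theorem coeff_enumerator (wt : A → σ →₀ ℕ) (d : σ →₀ ℕ) :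
    MvPowerSeries.coeff d (enumerator wt) = (Nat.card {a // wt a = d} : ℚ) := rfl

theorem enumerator_equiv (e : A ≃ B) {wa : A → σ →₀ ℕ} {wb : B → σ →₀ ℕ}
    (h : ∀ a, wb (e a) = wa a) : enumerator wa = enumerator wb := by
  ext d
  rw [coeff_enumerator, coeff_enumerator,
    Nat.card_congr (e.subtypeEquiv (q := fun b => wb b = d) fun a => by rw [h])]

variable {wa : A → σ →₀ ℕ} {wb : B → σ →₀ ℕ}

theorem enumerator_sum (ha : ∀ d, Finite {a // wa a = d}) (hb : ∀ d, Finite {b // wb b = d}) :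
    enumerator (Sum.elim wa wb) = enumerator wa + enumerator wb := by
  ext d
  have := ha d
  have := hb d
  rw [map_add, coeff_enumerator, coeff_enumerator, coeff_enumerator, ← Nat.cast_add,
    ← Nat.card_sum]
  exact congrArg _ (Nat.card_congr (Equiv.subtypeSum (p := fun x => Sum.elim wa wb x = d)))

/-- The pairs of total exponent `d`, sorted by the exponents of the two components. -/
def prodFiberEquiv [DecidableEq σ] (wa : A → σ →₀ ℕ) (wb : B → σ →₀ ℕ) (d : σ →₀ ℕ) :
    {x : A × B // wa x.1 + wb x.2 = d} ≃
      Σ p : Finset.HasAntidiagonal.antidiagonal d, {a // wa a = p.1.1} × {b // wb b = p.1.2} where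
  toFun x := ⟨⟨(wa x.1.1, wb x.1.2), Finset.HasAntidiagonal.mem_antidiagonal.2 x.2⟩,
    ⟨x.1.1, rfl⟩, ⟨x.1.2, rfl⟩⟩
  invFun y := ⟨(y.2.1, y.2.2), by
    rw [y.2.1.2, y.2.2.2]; exact Finset.HasAntidiagonal.mem_antidiagonal.1 y.1.2⟩
  left_inv x := rfl
  right_inv := by
    rintro ⟨⟨⟨i, j⟩, h⟩, ⟨a, ha⟩, ⟨b, hb⟩⟩
    obtain rfl : wa a = i := ha
    obtain rfl : wb b = j := hb
    rfl

theorem finite_prodFiber (ha : ∀ d, Finite {a // wa a = d}) (hb : ∀ d, Finite {b // wb b = d})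
    (d : σ →₀ ℕ) : Finite {x : A × B // wa x.1 + wb x.2 = d} := by
  classical
  exact Finite.of_equiv _ (prodFiberEquiv wa wb d).symm

theorem enumerator_prod [DecidableEq σ] (ha : ∀ d, Finite {a // wa a = d})
    (hb : ∀ d, Finite {b // wb b = d}) :
    enumerator (fun x : A × B => wa x.1 + wb x.2) = enumerator wa * enumerator wb := by
  ext d
  rw [MvPowerSeries.coeff_mul, coeff_enumerator]
  have := fun p : Finset.HasAntidiagonal.antidiagonal d => ha p.1.1
  have := fun p : Finset.HasAntidiagonal.antidiagonal d => hb p.1.2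
  rw [Nat.card_congr (prodFiberEquiv wa wb d), Nat.card_sigma, Nat.cast_sum,
    Finset.sum_coe_sort (Finset.HasAntidiagonal.antidiagonal d)
      (fun p => ((Nat.card ({a // wa a = p.1} × {b // wb b = p.2}) : ℕ) : ℚ))]
  refine Finset.sum_congr rfl fun p _ => ?_
  rw [Nat.card_prod, Nat.cast_mul, coeff_enumerator, coeff_enumerator]

theorem enumerator_add_const (wt : A → σ →₀ ℕ) (c : σ →₀ ℕ) :
    enumerator (fun a => c + wt a) = MvPowerSeries.monomial c 1 * enumerator wt := by
  classical
  ext d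
  rw [MvPowerSeries.coeff_monomial_mul, coeff_enumerator]
  split_ifs with h
  · rw [one_mul, coeff_enumerator]
    congr 1
    refine Nat.card_congr (Equiv.subtypeEquivRight fun a => ?_)
    rw [eq_tsub_iff_add_eq_of_le h, add_comm]
  · have : IsEmpty {a // c + wt a = d} := ⟨fun ⟨a, ha⟩ => h (ha ▸ le_self_add)⟩
    simp

theorem enumerator_const_zero : enumerator (fun _ : Unit => (0 : σ →₀ ℕ)) = 1 := by
  classical
  ext d
  rw [coeff_enumerator, MvPowerSeries.coeff_one]
  split_ifs with h
  · subst h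
    simp
  · have : IsEmpty {a : Unit // (0 : σ →₀ ℕ) = d} := ⟨fun ⟨a, ha⟩ => h ha.symm⟩
    simp

end Enumerator

/-! ### Generating functions of binary trees -/

namespace BinaryTree

theorem finite_weight_le (n : ℕ) : {t : BinaryTree ℕ+ | t.weight ≤ n}.Finite := by
  induction n with
  | zero =>
    refine (Set.finite_singleton nil).subset fun t ht => ?_
    cases t with
    | nil => rfl
    | node w l r =>
      have h : (w : ℕ) + l.weight + r.weight ≤ 0 := ht
      have := w.pos
      omega
  | succ n ih =>
    refine ((Set.finite_singleton nil).union (((Set.finite_Iic (⟨n + 1, n.succ_pos⟩ : ℕ+)).prod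
      (ih.prod ih)).image fun x => node x.1 x.2.1 x.2.2)).subset fun t ht => ?_
    cases t with
    | nil => exact .inl rfl
    | node w l r =>
      have h : (w : ℕ) + l.weight + r.weight ≤ n + 1 := ht
      have := w.pos
      refine .inr ⟨(w, l, r), ⟨?_, ?_, ?_⟩, rfl⟩
      · exact PNat.coe_le_coe _ _ |>.1 (show (w : ℕ) ≤ n + 1 by omega)
      · show l.weight ≤ n
        omega
      · show r.weight ≤ n
        omega

theorem numNodes_le_weight (t : BinaryTree ℕ+) : t.numNodes ≤ t.weight := by
  induction t with
  | nil => exact le_rfl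
  | node w l r hl hr =>
    have := w.pos
    simp only [numNodes, weight]
    omega

/-- A binary tree is empty or has a root, of weight `k + 1`, with two subtrees. -/
def decompose : BinaryTree ℕ+ ≃ Unit ⊕ (ℕ × (BinaryTree ℕ+ × BinaryTree ℕ+)) where
  toFun
    | nil => .inl ()
    | node w l r => .inr (w.natPred, l, r)
  invFun
    | .inl _ => nil
    | .inr (k, l, r) => node k.succPNat l r
  left_inv := by rintro (_ | ⟨w, l, r⟩) <;> simp
  right_inv := by rintro (_ | ⟨k, l, r⟩) <;> simp

/-- The functional equation of the generating function of binary trees, counted by an exponent to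
which a node of label `w` contributes `w • τ + c`. -/
theorem enumerator_eq {σ : Type} [DecidableEq σ] {μ : BinaryTree ℕ+ → σ →₀ ℕ} {τ c : σ →₀ ℕ}
    (hτ : τ ≠ 0) (hfin : ∀ d, Finite {t // μ t = d}) (hnil : μ nil = 0)
    (hnode : ∀ w l r, μ (node w l r) = c + ((w : ℕ) • τ + (μ l + μ r))) :
    (1 - MvPowerSeries.monomial τ 1) * (enumerator μ - 1) =
      MvPowerSeries.monomial (c + τ) 1 * enumerator μ ^ 2 := by
  obtain ⟨i, hi⟩ := DFunLike.ne_iff.1 hτ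
  have hi : τ i ≠ 0 := hi
  have hN : ∀ d, Finite {k : ℕ // k • τ = d} := by
    intro d
    refine Finite.of_injective (β := Unit) (fun _ => ()) ?_
    rintro ⟨k, rfl⟩ ⟨k', h⟩ -
    have := DFunLike.congr_fun h i
    simp only [Finsupp.smul_apply, smul_eq_mul] at this
    exact Subtype.ext (Nat.eq_of_mul_eq_mul_right (Nat.pos_of_ne_zero hi) this.symm)
  -- The enumerator of the natural numbers, with `k` counted by `k • τ`, is `1 / (1 - X ^ τ)`.
  have hG : (1 - MvPowerSeries.monomial τ 1) * enumerator (fun k : ℕ => k • τ) = 1 := by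
    have h : enumerator (fun k : ℕ => k • τ) =
        MvPowerSeries.monomial τ 1 * enumerator (fun k : ℕ => k • τ) + 1 := by
      rw [← enumerator_add_const, ← enumerator_const_zero, ← enumerator_sum]
      · refine enumerator_equiv Equiv.natEquivNatSumPUnit.{0} fun k => ?_
        cases k with
        | zero => exact (zero_smul ℕ τ).symm
        | succ k =>
          change τ + k • τ = (k + 1) • τ
          rw [add_smul, one_smul, add_comm]
      · intro d
        refine Finite.of_injective (β := {k : ℕ // k • τ = d - τ})
          (fun k => ⟨k, eq_tsub_of_add_eq (by rw [add_comm]; exact k.2)⟩) fun x y h => ?_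
        exact Subtype.ext (congrArg (fun z => z.1) h)
      · exact fun d => inferInstance
    linear_combination h
  have hF : enumerator μ = 1 + MvPowerSeries.monomial (c + τ) 1 *
      (enumerator (fun k : ℕ => k • τ) * (enumerator μ * enumerator μ)) := by
    rw [← enumerator_prod hfin hfin, ← enumerator_prod hN (finite_prodFiber hfin hfin),
      ← enumerator_add_const, ← enumerator_const_zero, ← enumerator_sum]
    · refine enumerator_equiv decompose fun t => ?_
      cases t with
      | nil => simp [decompose, hnil]
      | node w l r =>
        simp only [decompose, Equiv.coe_fn_mk, Sum.elim_inr, hnode]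
        conv_rhs => rw [← PNat.natPred_add_one w]
        rw [add_smul, one_smul]
        abel
    · exact fun d => inferInstance
    · intro d
      have := finite_prodFiber hN (finite_prodFiber hfin hfin) (d - (c + τ))
      refine Finite.of_injective (β := {x : ℕ × (BinaryTree ℕ+ × BinaryTree ℕ+) //
          x.1 • τ + (μ x.2.1 + μ x.2.2) = d - (c + τ)})
        (fun x => ⟨x, eq_tsub_of_add_eq (by rw [add_comm]; exact x.2)⟩) fun x y h => ?_
      exact Subtype.ext (congrArg (fun z => z.1) h)
  linear_combination (1 - MvPowerSeries.monomial τ 1) * hF +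
    MvPowerSeries.monomial (c + τ) 1 * enumerator μ ^ 2 * hG

end BinaryTree

/-! ### The generating functions of rooted trees -/

theorem finite_binaryTree_weight (n : ℕ) : Finite {t : BinaryTree ℕ+ // t.weight = n} :=
  (BinaryTree.finite_weight_le n).subset fun _ h => le_of_eq h

theorem rootedSeries_eq : rootedSeries =
    enumerator (fun t : BinaryTree ℕ+ => Finsupp.single () t.weight) := by
  ext n
  rw [rootedSeries, PowerSeries.coeff_mk, rootedCount_eq, PowerSeries.coeff, coeff_enumerator]
  simp only [(Finsupp.single_injective ()).eq_iff]

theorem rootedSeries_equation :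
    (1 - PowerSeries.X) * (rootedSeries - 1) = PowerSeries.X * rootedSeries ^ 2 := by
  have h := BinaryTree.enumerator_eq (σ := Unit)
    (μ := fun t => Finsupp.single () t.weight) (τ := Finsupp.single () 1) (c := 0) (by simp)
    (fun d => ?_) (by simp [BinaryTree.weight]) (fun w l r => ?_)
  · rw [← rootedSeries_eq, zero_add] at h
    exact h
  · obtain ⟨n, rfl⟩ : ∃ n, d = Finsupp.single () n := ⟨d (), by ext; simp⟩
    simp only [(Finsupp.single_injective ()).eq_iff]
    exact finite_binaryTree_weight n
  · ext
    simp [BinaryTree.weight, add_assoc]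

theorem rootedEdgeSeries_eq : rootedEdgeSeries = enumerator (fun t : BinaryTree ℕ+ =>
    Finsupp.single (0 : Fin 2) t.numNodes + Finsupp.single 1 t.weight) := by
  ext d
  rw [coeff_enumerator]
  change (rootedEdgeCount (d 0) (d 1) : ℚ) = _
  rw [rootedEdgeCount_eq]
  congr 1
  refine Nat.card_congr (Equiv.subtypeEquivRight fun t => ?_)
  rw [Finsupp.ext_iff, Fin.forall_fin_two, and_comm]
  simp

theorem rootedEdgeSeries_equation :
    (1 - MvPowerSeries.X 1) * (rootedEdgeSeries - 1) =
      MvPowerSeries.X 0 * MvPowerSeries.X 1 * rootedEdgeSeries ^ 2 := by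
  have h := BinaryTree.enumerator_eq (σ := Fin 2)
    (μ := fun t => Finsupp.single (0 : Fin 2) t.numNodes + Finsupp.single 1 t.weight)
    (τ := Finsupp.single 1 1) (c := Finsupp.single 0 1) (by simp)
    (fun d => ?_) (by simp [BinaryTree.weight]) (fun w l r => ?_)
  · rw [← rootedEdgeSeries_eq] at h
    rwa [MvPowerSeries.X, MvPowerSeries.X, MvPowerSeries.monomial_mul_monomial, one_mul]
  · have := finite_binaryTree_weight (d 1)
    refine Finite.of_injective (β := {t : BinaryTree ℕ+ // t.weight = d 1})
      (fun t => ⟨t, by simpa using DFunLike.congr_fun t.2 1⟩) fun x y h => ?_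
    exact Subtype.ext (congrArg (fun z => z.1) h)
  · ext i
    fin_cases i
    · simp [BinaryTree.weight]; ring
    · simp [BinaryTree.weight]; ring

theorem exists_sqrt_rootedSeries : ∃ S : PowerSeries ℚ,
    S ^ 2 = 1 - 6 * PowerSeries.X + 5 * PowerSeries.X ^ 2 ∧
    PowerSeries.constantCoeff S = 1 ∧
    2 * PowerSeries.X * rootedSeries = 1 - PowerSeries.X - S := by
  refine ⟨1 - PowerSeries.X - 2 * PowerSeries.X * rootedSeries, ?_, by simp, by ring⟩
  linear_combination (-4 * PowerSeries.X) * rootedSeries_equation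

theorem exists_sqrt_rootedEdgeSeries : ∃ S : MvPowerSeries (Fin 2) ℚ,
    S ^ 2 = 1 - (2 + 4 * MvPowerSeries.X 0) * MvPowerSeries.X 1
      + (1 + 4 * MvPowerSeries.X 0) * MvPowerSeries.X 1 ^ 2 ∧
    MvPowerSeries.constantCoeff S = 1 ∧
    2 * MvPowerSeries.X 0 * MvPowerSeries.X 1 * rootedEdgeSeries
      = 1 - MvPowerSeries.X 1 - S := by
  refine ⟨1 - MvPowerSeries.X 1 - 2 * MvPowerSeries.X 0 * MvPowerSeries.X 1 * rootedEdgeSeries,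
    ?_, by simp, by ring⟩
  linear_combination (-4 * MvPowerSeries.X 0 * MvPowerSeries.X 1) * rootedEdgeSeries_equation

/-! ### Recurrences -/

theorem rootedCount_zero : rootedCount 0 = 1 := by
  rw [rootedCount_eq, Nat.card_eq_one_iff_unique]
  refine ⟨⟨?_⟩, ⟨⟨.nil, rfl⟩⟩⟩
  have : ∀ t : BinaryTree ℕ+, t.weight = 0 → t = .nil := by
    rintro (_ | ⟨w, l, r⟩) h
    · rfl
    · have := w.pos
      simp only [BinaryTree.weight] at h
      omega
  rintro ⟨s, hs⟩ ⟨t, ht⟩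
  simp [this s hs, this t ht]

theorem rootedCount_succ_cast (n : ℕ) : (rootedCount (n + 1) : ℚ) =
    (if n = 0 then 0 else (rootedCount n : ℚ)) +
      ∑ k ∈ Finset.range (n + 1), (rootedCount k : ℚ) * rootedCount (n - k) := by
  have h := congrArg (PowerSeries.coeff (n + 1)) rootedSeries_equation
  have hc : ∀ k, PowerSeries.coeff k rootedSeries = (rootedCount k : ℚ) := fun k =>
    PowerSeries.coeff_mk _ _
  rw [PowerSeries.coeff_succ_X_mul, sub_mul, one_mul, map_sub, PowerSeries.coeff_succ_X_mul,
    map_sub, map_sub, hc, hc, PowerSeries.coeff_one, PowerSeries.coeff_one, sq,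
    PowerSeries.coeff_mul, Finset.Nat.sum_antidiagonal_eq_sum_range_succ_mk] at h
  simp only [hc] at h
  rw [← h]
  by_cases hn : n = 0
  · subst hn; simp [rootedCount_zero]
  · simp [hn]

theorem rootedCount_one : rootedCount 1 = 1 := by
  have := rootedCount_succ_cast 0
  simp [rootedCount_zero] at this
  exact_mod_cast this

theorem rootedCount_succ {n : ℕ} (hn : 1 ≤ n) : rootedCount (n + 1) =
    rootedCount n + ∑ k ∈ Finset.range (n + 1), rootedCount k * rootedCount (n - k) := by
  have := rootedCount_succ_cast n
  rw [if_neg (by omega)] at this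
  exact_mod_cast this

theorem rootedCount_values : rootedCount 2 = 3 ∧ rootedCount 3 = 10 ∧
    rootedCount 4 = 36 ∧ rootedCount 5 = 137 ∧ rootedCount 6 = 543 ∧
    rootedCount 7 = 2219 ∧ rootedCount 8 = 9285 := by
  have h0 := rootedCount_zero
  have h1 := rootedCount_one
  have h2 : rootedCount 2 = 3 := by
    simp [rootedCount_succ (n := 1), Finset.sum_range_succ, h0, h1]
  have h3 : rootedCount 3 = 10 := by
    simp [rootedCount_succ (n := 2), Finset.sum_range_succ, h0, h1, h2]
  have h4 : rootedCount 4 = 36 := by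
    simp [rootedCount_succ (n := 3), Finset.sum_range_succ, h0, h1, h2, h3]
  have h5 : rootedCount 5 = 137 := by
    simp [rootedCount_succ (n := 4), Finset.sum_range_succ, h0, h1, h2, h3, h4]
  have h6 : rootedCount 6 = 543 := by
    simp [rootedCount_succ (n := 5), Finset.sum_range_succ, h0, h1, h2, h3, h4, h5]
  have h7 : rootedCount 7 = 2219 := by
    simp [rootedCount_succ (n := 6), Finset.sum_range_succ, h0, h1, h2, h3, h4, h5, h6]
  have h8 : rootedCount 8 = 9285 := by
    simp [rootedCount_succ (n := 7), Finset.sum_range_succ, h0, h1, h2, h3, h4, h5, h6, h7]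
  exact ⟨h2, h3, h4, h5, h6, h7, h8⟩

/-! ### The numbers of rooted trees with given numbers of edges -/

theorem rootedEdgeCount_zero_zero : rootedEdgeCount 0 0 = 1 := by
  rw [rootedEdgeCount_eq, Nat.card_eq_one_iff_unique]
  refine ⟨⟨?_⟩, ⟨⟨.nil, rfl, rfl⟩⟩⟩
  have : ∀ t : BinaryTree ℕ+, t.numNodes = 0 → t = .nil := by
    rintro (_ | ⟨w, l, r⟩) h
    · rfl
    · simp at h
  rintro ⟨s, hs⟩ ⟨t, ht⟩
  simp [this s hs.2, this t ht.2]

theorem rootedEdgeCount_eq_zero_of_lt {m n : ℕ} (h : n < m) : rootedEdgeCount m n = 0 := by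
  rw [rootedEdgeCount_eq, Nat.card_eq_zero]
  refine .inl ⟨?_⟩
  rintro ⟨t, rfl, rfl⟩
  exact absurd t.numNodes_le_weight (not_le.2 h)

theorem rootedEdgeCount_zero_left {n : ℕ} (h : 1 ≤ n) : rootedEdgeCount 0 n = 0 := by
  rw [rootedEdgeCount_eq, Nat.card_eq_zero]
  refine .inl ⟨?_⟩
  rintro ⟨_ | ⟨w, l, r⟩, h1, h2⟩
  · simp only [BinaryTree.weight] at h1
    omega
  · simp at h2

/-- The exponent `(i, j)` of a power series in two variables. -/
noncomputable def exponent (i j : ℕ) : Fin 2 →₀ ℕ := Finsupp.single 0 i + Finsupp.single 1 j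

theorem exponent_add (i j k l : ℕ) :
    exponent i j + exponent k l = exponent (i + k) (j + l) := by
  simp only [exponent, Finsupp.single_add]
  abel

theorem exponent_injective {i j k l : ℕ} (h : exponent i j = exponent k l) : i = k ∧ j = l :=
  ⟨by simpa [exponent] using DFunLike.congr_fun h 0,
    by simpa [exponent] using DFunLike.congr_fun h 1⟩

theorem eq_exponent (d : Fin 2 →₀ ℕ) : d = exponent (d 0) (d 1) := by
  ext i
  fin_cases i <;> simp [exponent]

theorem sum_antidiagonal_exponent (f : (Fin 2 →₀ ℕ) × (Fin 2 →₀ ℕ) → ℚ) (m n : ℕ) :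
    ∑ p ∈ Finset.HasAntidiagonal.antidiagonal (exponent m n), f p =
      ∑ p ∈ Finset.HasAntidiagonal.antidiagonal m, ∑ q ∈ Finset.HasAntidiagonal.antidiagonal n,
        f (exponent p.1 q.1, exponent p.2 q.2) := by
  rw [← Finset.sum_product']
  symm
  refine Finset.sum_bij (fun x _ => (exponent x.1.1 x.2.1, exponent x.1.2 x.2.2)) ?_ ?_ ?_ ?_
  · rintro ⟨⟨i, k⟩, ⟨j, l⟩⟩ h
    simp only [Finset.mem_product, Finset.HasAntidiagonal.mem_antidiagonal] at h ⊢
    rw [exponent_add, h.1, h.2]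
  · rintro ⟨⟨i, k⟩, ⟨j, l⟩⟩ - ⟨⟨i', k'⟩, ⟨j', l'⟩⟩ - h
    obtain ⟨h1, h2⟩ := Prod.mk.inj h
    obtain ⟨rfl, rfl⟩ := exponent_injective h1
    obtain ⟨rfl, rfl⟩ := exponent_injective h2
    rfl
  · rintro ⟨a, b⟩ h
    rw [Finset.HasAntidiagonal.mem_antidiagonal, eq_exponent a, eq_exponent b, exponent_add] at h
    obtain ⟨h1, h2⟩ := exponent_injective h
    refine ⟨((a 0, b 0), (a 1, b 1)), ?_, ?_⟩
    · simp [h1, h2]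
    · simp [← eq_exponent]
  · intros
    rfl

theorem coeff_rootedEdgeSeries (m n : ℕ) :
    MvPowerSeries.coeff (exponent m n) rootedEdgeSeries = (rootedEdgeCount m n : ℚ) := by
  change (rootedEdgeCount (exponent m n 0) (exponent m n 1) : ℚ) = _
  simp [exponent]

theorem rootedEdgeCount_succ_succ (m n : ℕ) : (rootedEdgeCount (m + 1) (n + 1) : ℚ) =
    rootedEdgeCount (m + 1) n + ∑ p ∈ Finset.HasAntidiagonal.antidiagonal m,
      ∑ q ∈ Finset.HasAntidiagonal.antidiagonal n,
        (rootedEdgeCount p.1 q.1 : ℚ) * rootedEdgeCount p.2 q.2 := by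
  have h := congrArg (MvPowerSeries.coeff (exponent (m + 1) (n + 1))) rootedEdgeSeries_equation
  have h1 : (MvPowerSeries.X 1 : MvPowerSeries (Fin 2) ℚ) =
      MvPowerSeries.monomial (exponent 0 1) 1 := by simp [exponent, MvPowerSeries.X]
  have h01 : (MvPowerSeries.X 0 * MvPowerSeries.X 1 : MvPowerSeries (Fin 2) ℚ) =
      MvPowerSeries.monomial (exponent 1 1) 1 := by
    simp [exponent, MvPowerSeries.X, MvPowerSeries.monomial_mul_monomial]
  have e1 : exponent (m + 1) (n + 1) = exponent 0 1 + exponent (m + 1) n := by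
    rw [exponent_add, zero_add, add_comm n]
  have e2 : exponent (m + 1) (n + 1) = exponent 1 1 + exponent m n := by
    rw [exponent_add, add_comm m, add_comm n]
  have hne : ∀ k, exponent (m + 1) k ≠ 0 := fun k hk => by
    simpa [exponent] using DFunLike.congr_fun hk 0
  rw [sub_mul, one_mul, h01, e2, MvPowerSeries.coeff_add_monomial_mul, ← e2, one_mul, sq,
    MvPowerSeries.coeff_mul, sum_antidiagonal_exponent, map_sub, h1, map_sub,
    coeff_rootedEdgeSeries, MvPowerSeries.coeff_one, if_neg (hne _), e1,
    MvPowerSeries.coeff_add_monomial_mul, map_sub,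
    MvPowerSeries.coeff_one, if_neg (hne _), coeff_rootedEdgeSeries] at h
  simp only [coeff_rootedEdgeSeries] at h
  linear_combination h

/-- The generating function by weight of the rooted trees with `m` edges. -/
noncomputable def edgeSeries (m : ℕ) : PowerSeries ℚ :=
  PowerSeries.mk fun n => (rootedEdgeCount m n : ℚ)

theorem edgeSeries_zero : edgeSeries 0 = 1 := by
  ext n
  rw [edgeSeries, PowerSeries.coeff_mk, PowerSeries.coeff_one]
  split_ifs with h
  · subst h
    rw [rootedEdgeCount_zero_zero, Nat.cast_one]
  · rw [rootedEdgeCount_zero_left (by omega), Nat.cast_zero]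

theorem edgeSeries_succ (m : ℕ) : (1 - PowerSeries.X) * edgeSeries (m + 1) =
    PowerSeries.X * ∑ p ∈ Finset.HasAntidiagonal.antidiagonal m,
      edgeSeries p.1 * edgeSeries p.2 := by
  ext n
  rw [sub_mul, one_mul, map_sub]
  cases n with
  | zero =>
    simp [edgeSeries, rootedEdgeCount_eq_zero_of_lt]
  | succ n =>
    rw [PowerSeries.coeff_succ_X_mul, PowerSeries.coeff_succ_X_mul, map_sum, edgeSeries,
      PowerSeries.coeff_mk, PowerSeries.coeff_mk, rootedEdgeCount_succ_succ, add_sub_cancel_left]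
    refine Finset.sum_congr rfl fun p _ => ?_
    rw [PowerSeries.coeff_mul]
    simp [edgeSeries]

/-- A plane tree with `m` edges can be weighted by any composition of the weight into `m` parts. -/
theorem edgeSeries_eq (m : ℕ) : edgeSeries m =
    (catalan m : PowerSeries ℚ) * (PowerSeries.X * PowerSeries.mk 1) ^ m := by
  have hG := PowerSeries.mk_one_mul_one_sub_eq_one ℚ
  induction m using Nat.strong_induction_on with
  | _ m ih =>
    cases m with
    | zero => simp [edgeSeries_zero]
    | succ m =>
      have hsum : ∑ p ∈ Finset.HasAntidiagonal.antidiagonal m, edgeSeries p.1 * edgeSeries p.2 =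
          (catalan (m + 1) : PowerSeries ℚ) * (PowerSeries.X * PowerSeries.mk 1) ^ m := by
        rw [catalan_succ', Nat.cast_sum, Finset.sum_mul]
        refine Finset.sum_congr rfl fun p hp => ?_
        have hp := Finset.HasAntidiagonal.mem_antidiagonal.1 hp
        rw [ih p.1 (by omega), ih p.2 (by omega), ← hp, pow_add, Nat.cast_mul]
        ring
      have h := edgeSeries_succ m
      rw [hsum] at h
      linear_combination PowerSeries.mk 1 * h - edgeSeries (m + 1) * hG

theorem rootedEdgeCount_eq_choose {m n : ℕ} (hm : 1 ≤ m) (hn : 1 ≤ n) :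
    rootedEdgeCount m n = (n - 1).choose (m - 1) * catalan m := by
  rcases lt_or_ge n m with h | h
  · rw [rootedEdgeCount_eq_zero_of_lt h, Nat.choose_eq_zero_of_lt (by omega), zero_mul]
  · obtain ⟨d, rfl⟩ : ∃ d, m = d + 1 := ⟨m - 1, by omega⟩
    obtain ⟨k, rfl⟩ : ∃ k, n = k + (d + 1) := ⟨n - (d + 1), by omega⟩
    have h := congrArg (PowerSeries.coeff (k + (d + 1))) (edgeSeries_eq (d + 1))
    rw [edgeSeries, PowerSeries.coeff_mk, mul_pow, PowerSeries.mk_one_pow_eq_mk_choose_add,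
      mul_left_comm, PowerSeries.coeff_X_pow_mul, ← map_natCast (PowerSeries.C (R := ℚ)),
      PowerSeries.coeff_C_mul, PowerSeries.coeff_mk] at h
    have h' : rootedEdgeCount (d + 1) (k + (d + 1)) = catalan (d + 1) * (d + k).choose d := by
      exact_mod_cast h
    rw [h', mul_comm, show k + (d + 1) - 1 = d + k by omega, Nat.add_sub_cancel]

theorem catalan_eq_cast (m : ℕ) :
    (catalan m : ℚ) = 1 / ((m : ℚ) + 1) * ((2 * m).choose m : ℚ) := by
  have h := succ_mul_catalan_eq_centralBinom m
  rw [Nat.centralBinom_eq_two_mul_choose] at h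
  rw [← h]
  push_cast
  field_simp

theorem rootedEdgeCount_values : rootedEdgeCount 1 1 = 1 ∧
    rootedEdgeCount 1 2 = 1 ∧ rootedEdgeCount 2 2 = 2 ∧
    rootedEdgeCount 1 3 = 1 ∧ rootedEdgeCount 2 3 = 4 ∧ rootedEdgeCount 3 3 = 5 ∧
    rootedEdgeCount 1 4 = 1 ∧ rootedEdgeCount 2 4 = 6 ∧ rootedEdgeCount 3 4 = 15 ∧
    rootedEdgeCount 4 4 = 14 := by
  have h4 : catalan 4 = 14 := by
    rw [catalan_eq_centralBinom_div]
    decide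
  simp [rootedEdgeCount_eq_choose, catalan_two, catalan_three, h4]

theorem rootedCount_eq_sum (n : ℕ) :
    rootedCount n = ∑ m ∈ Finset.range (n + 1), rootedEdgeCount m n := by
  have := finite_binaryTree_weight n
  have hf : ∀ m : Fin (n + 1), Finite {t : BinaryTree ℕ+ // t.weight = n ∧ t.numNodes = m} :=
    fun m => Finite.of_injective (β := {t : BinaryTree ℕ+ // t.weight = n})
      (fun t => ⟨t, t.2.1⟩) fun x y h => Subtype.ext (congrArg (fun z => z.1) h)
  let e : {t : BinaryTree ℕ+ // t.weight = n} ≃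
      Σ m : Fin (n + 1), {t : BinaryTree ℕ+ // t.weight = n ∧ t.numNodes = m} :=
    { toFun := fun t => ⟨⟨t.1.numNodes, Nat.lt_succ_of_le (t.1.numNodes_le_weight.trans_eq t.2)⟩,
        ⟨t.1, t.2, rfl⟩⟩
      invFun := fun x => ⟨x.2.1, x.2.2.1⟩
      left_inv := fun t => rfl
      right_inv := by
        rintro ⟨⟨m, hm⟩, ⟨t, ht, h⟩⟩
        obtain rfl : t.numNodes = m := h
        rfl }
  rw [rootedCount_eq, Nat.card_congr e, Nat.card_sigma, Finset.sum_range]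
  exact Finset.sum_congr rfl fun m _ => (rootedEdgeCount_eq _ _).symm

/-! ### Counting unrooted trees by their automorphisms -/

namespace RootedWeightedTree

open WeightedTree

/-- Forgetting the root, on isomorphism classes. -/
def forget : Quotient RootedWeightedTree.isoSetoid → Quotient WeightedTree.isoSetoid :=
  Quotient.map toWeightedTree fun _ _ ⟨f, _⟩ => ⟨f⟩

/-- The class of the tree `T` rooted at the edge `e`. -/
def rootAt (T : WeightedTree) (e : T.Edge) : Quotient RootedWeightedTree.isoSetoid :=
  ⟦⟨T, some e, by simp⟩⟧

theorem rootAt_eq_iff {T : WeightedTree} {e e' : T.Edge} :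
    rootAt T e = rootAt T e' ↔ ∃ g : Aut T, g.edge e = e' := by
  unfold rootAt
  rw [Quotient.eq]
  exact exists_congr fun g => Option.some_inj

theorem exists_rootAt {T : WeightedTree} (hT : Nonempty T.Edge)
    {q : Quotient RootedWeightedTree.isoSetoid} (hq : forget q = ⟦T⟧) : ∃ e, rootAt T e = q := by
  induction q using Quotient.inductionOn with
  | _ R =>
    obtain ⟨f⟩ : R.toWeightedTree ≈ T := Quotient.exact hq
    cases hr : R.root with
    | none => exact ((R.isEmpty_of_root_eq_none hr).elim (f.edge.symm hT.some))
    | some r => exact ⟨f.edge r, Quotient.sound ⟨f.symm, by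
        rw [hr]
        exact congrArg some (f.edge.symm_apply_apply r)⟩⟩

/-- Automorphisms act freely on edges, so the numbers of rootings of `T` and of automorphisms
multiply to the number of edges. -/
theorem card_forget_fiber_mul (T : WeightedTree) (hT : Nonempty T.Edge) :
    Nat.card {q // forget q = ⟦T⟧} * Nat.card (Aut T) = T.numEdges := by
  let F : T.Edge → {q // forget q = ⟦T⟧} := fun e => ⟨rootAt T e, rfl⟩
  have hF : Function.Surjective F := fun q =>
    (exists_rootAt hT q.2).imp fun _ h => Subtype.ext h
  have := Finite.of_surjective F hF
  have := Fintype.ofFinite {q // forget q = ⟦T⟧}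
  have hfib : ∀ q, Nat.card {e // F e = q} = Nat.card (Aut T) := by
    intro q
    obtain ⟨e₀, rfl⟩ := hF q
    symm
    refine Nat.card_congr (Equiv.ofBijective (fun g : Aut T => ⟨g.edge e₀,
      Subtype.ext (rootAt_eq_iff.2 ⟨g.symm, g.edge.symm_apply_apply e₀⟩)⟩) ⟨?_, ?_⟩)
    · intro g g' h
      exact Iso.ext_of_edge (congrArg Subtype.val h)
    · rintro ⟨e, he⟩
      obtain ⟨g, hg⟩ := rootAt_eq_iff.1 (congrArg Subtype.val he).symm
      exact ⟨g, Subtype.ext hg⟩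
  rw [WeightedTree.numEdges, ← Nat.card_congr (Equiv.sigmaFiberEquiv F), Nat.card_sigma,
    Finset.sum_congr rfl fun q _ => hfib q, Finset.sum_const, smul_eq_mul, Finset.card_univ,
    Nat.card_eq_fintype_card]

theorem classes_finite (n : ℕ) : (classes n).Finite := by
  rw [classes_eq]
  exact Set.Finite.image _ ((BinaryTree.finite_weight_le n).subset fun _ h => le_of_eq h)

theorem forget_mem_classes_iff {n : ℕ} {q : Quotient RootedWeightedTree.isoSetoid} :
    forget q ∈ WeightedTree.classes n ↔ q ∈ classes n := by
  constructor
  · rintro ⟨T, hT, rfl⟩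
    induction q using Quotient.inductionOn with
    | _ R =>
      obtain ⟨f⟩ : T ≈ R.toWeightedTree := Quotient.exact hT
      exact ⟨R, rfl, f.totalWeight_eq⟩
  · rintro ⟨R, rfl, rfl⟩
    exact ⟨R.toWeightedTree, rfl, rfl⟩

theorem forget_surjective : Function.Surjective forget := by
  intro q
  induction q using Quotient.inductionOn with
  | _ T =>
    rcases isEmpty_or_nonempty T.Edge with h | ⟨⟨e⟩⟩
    · exact ⟨⟦⟨T, none, fun _ => h⟩⟧, rfl⟩
    · exact ⟨rootAt T e, rfl⟩

end RootedWeightedTree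

namespace WeightedTree

theorem classes_finite (n : ℕ) : (classes n).Finite := by
  refine ((RootedWeightedTree.classes_finite n).image RootedWeightedTree.forget).subset ?_
  intro q hq
  obtain ⟨r, rfl⟩ := RootedWeightedTree.forget_surjective q
  exact ⟨r, RootedWeightedTree.forget_mem_classes_iff.1 hq, rfl⟩

theorem nonempty_edge_of_totalWeight_ne_zero {T : WeightedTree} (h : T.totalWeight ≠ 0) :
    Nonempty T.Edge := by
  by_contra hE
  rw [not_nonempty_iff] at hE
  exact h (finsum_of_isEmpty _)

/-- The number of edges, as a function of the isomorphism class. -/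
noncomputable def classNumEdges : Quotient isoSetoid → ℕ :=
  Quotient.lift numEdges fun _ _ ⟨f⟩ => f.numEdges_eq.symm

/-- The reciprocal of the order of the automorphism group, in terms of the number of rootings. -/
theorem one_div_autOrder {n : ℕ} (hn : 1 ≤ n) {q : Quotient isoSetoid} (hq : q ∈ classes n) :
    1 / (autOrder q : ℚ) =
      (Nat.card {r // RootedWeightedTree.forget r = q} : ℚ) / classNumEdges q := by
  obtain ⟨T, rfl, hT⟩ := hq
  have hE := nonempty_edge_of_totalWeight_ne_zero (T := T) (by omega)
  have h := RootedWeightedTree.card_forget_fiber_mul T hE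
  have hpos : T.numEdges ≠ 0 := Nat.card_pos.ne'
  change 1 / (Nat.card (Aut T) : ℚ) = _ / (T.numEdges : ℚ)
  have h1 : (Nat.card (Aut T) : ℚ) ≠ 0 := by
    rintro h0
    rw [Nat.cast_eq_zero] at h0
    rw [h0, mul_zero] at h
    exact hpos h.symm
  have h2 : (T.numEdges : ℚ) ≠ 0 := Nat.cast_ne_zero.2 hpos
  rw [div_eq_div_iff h1 h2, one_mul]
  exact_mod_cast h.symm

end WeightedTree

open RootedWeightedTree in
theorem unrootedCount_eq {n : ℕ} (hn : 1 ≤ n) :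
    unrootedCount n = ∑ m ∈ Finset.Icc 1 n, (rootedEdgeCount m n : ℚ) / (m : ℚ) := by
  classical
  set R := (RootedWeightedTree.classes_finite n).toFinset with hR
  set U := (WeightedTree.classes_finite n).toFinset with hU
  have hmemR : ∀ r, r ∈ R ↔ r ∈ RootedWeightedTree.classes n := fun r => Set.Finite.mem_toFinset _
  have hmemU : ∀ q, q ∈ U ↔ q ∈ WeightedTree.classes n := fun q => Set.Finite.mem_toFinset _
  have h1 : unrootedCount n =
      ∑ r ∈ R, 1 / (WeightedTree.classNumEdges (forget r) : ℚ) := by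
    rw [unrootedCount, ← finsum_mem_congr (s := (U : Set _)) (by simp [hU]) fun _ _ => rfl,
      finsum_mem_coe_finset,
      ← Finset.sum_fiberwise_of_maps_to (s := R) (t := U) (g := forget)
        (fun r hr => (hmemU _).2 (forget_mem_classes_iff.2 ((hmemR r).1 hr)))]
    refine Finset.sum_congr rfl fun q hq => ?_
    rw [WeightedTree.one_div_autOrder hn ((hmemU q).1 hq),
      Finset.sum_congr rfl (g := fun _ => 1 / (WeightedTree.classNumEdges q : ℚ)) fun r hr => by
        rw [(Finset.mem_filter.1 hr).2], Finset.sum_const, nsmul_eq_mul, mul_one_div]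
    congr 2
    refine (Nat.subtype_card _ fun r => ?_)
    rw [Finset.mem_filter, hmemR, and_iff_right_iff_imp]
    rintro rfl
    exact forget_mem_classes_iff.1 ((hmemU _).1 hq)
  have hmaps : ∀ r ∈ R, WeightedTree.classNumEdges (forget r) ∈ Finset.Icc 1 n := by
    intro r hr
    rw [hmemR, RootedWeightedTree.classes_eq] at hr
    obtain ⟨t, rfl, rfl⟩ := hr
    have h : WeightedTree.classNumEdges (forget (classEquiv t)) = t.numNodes :=
      ofBinaryTree_numEdges t
    rw [h, Finset.mem_Icc]
    refine ⟨?_, t.numNodes_le_weight⟩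
    cases t with
    | nil => exact absurd hn (by simp [BinaryTree.weight])
    | node w l r => simp
  rw [h1, ← Finset.sum_fiberwise_of_maps_to hmaps]
  refine Finset.sum_congr rfl fun m _ => ?_
  rw [Finset.sum_congr rfl (g := fun _ => 1 / (m : ℚ)) fun r hr => by
    rw [(Finset.mem_filter.1 hr).2], Finset.sum_const, nsmul_eq_mul, mul_one_div]
  congr 2
  rw [rootedEdgeCount, ← Set.ncard_coe_finset]
  congr 1
  ext r
  rw [Finset.mem_coe, Finset.mem_filter, hmemR]
  constructor
  · rintro ⟨⟨T, rfl, hT⟩, hm⟩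
    exact ⟨T, rfl, hT, hm⟩
  · rintro ⟨T, rfl, hT, hm⟩
    exact ⟨⟨T, rfl, hT⟩, hm⟩

/-! ### Asymptotics -/

section Asymptotics

open Real Filter Topology

/-- `C(2m, m) / 4 ^ m`, multiplied by `m`; it is `√(m / π)` up to a bounded error. -/
noncomputable def scaledCentralBinom (m : ℕ) : ℝ := m * Nat.centralBinom m / 4 ^ m

theorem scaledCentralBinom_sq_mul (m : ℕ) :
    scaledCentralBinom m ^ 2 * (Wallis.W m * (2 * m + 1)) = m ^ 2 := by
  have hc : (m.factorial : ℝ) ^ 2 * Nat.centralBinom m = (2 * m).factorial := by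
    have h := Nat.choose_mul_factorial_mul_factorial (n := 2 * m) (k := m) (by omega)
    rw [show 2 * m - m = m by omega, ← Nat.centralBinom_eq_two_mul_choose] at h
    rw [← h]
    push_cast
    ring
  rw [Wallis.W_eq_factorial_ratio, ← hc, scaledCentralBinom]
  have h1 : (m.factorial : ℝ) ≠ 0 := Nat.cast_ne_zero.2 m.factorial_ne_zero
  have h2 : (Nat.centralBinom m : ℝ) ≠ 0 := Nat.cast_ne_zero.2 m.centralBinom_ne_zero
  have h3 : (2 * (m : ℝ) + 1) ≠ 0 := by positivity
  have h4 : (2 : ℝ) ^ (4 * m) = (4 ^ m) ^ 2 := by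
    rw [← pow_mul, show (4 : ℝ) = 2 ^ 2 by norm_num, ← pow_mul]
    congr 1
    ring
  rw [h4]
  field_simp

theorem scaledCentralBinom_nonneg (m : ℕ) : 0 ≤ scaledCentralBinom m := by
  unfold scaledCentralBinom
  positivity

/-- Wallis' bounds for the central binomial coefficient. -/
theorem abs_scaledCentralBinom_sub_le (m : ℕ) :
    |scaledCentralBinom m - √(m / π)| ≤ 1 := by
  set v := scaledCentralBinom m with hv
  have hv0 : 0 ≤ v := scaledCentralBinom_nonneg m
  have hW := scaledCentralBinom_sq_mul m
  rw [← hv] at hW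
  have hm : (0 : ℝ) ≤ m := Nat.cast_nonneg m
  have hπ := pi_gt_three
  have hu : v ^ 2 ≤ m / π := by
    have h1 : v ^ 2 * ((2 * (m : ℝ) + 1) / (2 * m + 2) * (π / 2) * (2 * m + 1)) ≤ m ^ 2 := by
      rw [← hW]
      gcongr
      exact Wallis.le_W m
    rw [le_div_iff₀ pi_pos]
    have h2 : v ^ 2 * ((2 * (m : ℝ) + 1) / (2 * m + 2) * (π / 2) * (2 * m + 1)) =
        v ^ 2 * π * ((2 * m + 1) ^ 2 / (4 * (m + 1))) := by
      field_simp
      ring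
    rw [h2, ← mul_div_assoc, div_le_iff₀ (by positivity)] at h1
    have h3 : v ^ 2 * π * (2 * m + 1) ^ 2 ≤ m * (2 * m + 1) ^ 2 := by nlinarith
    exact le_of_mul_le_mul_right h3 (by positivity)
  have hl : m / π - v ^ 2 ≤ 1 := by
    have h1 : (m : ℝ) ^ 2 ≤ v ^ 2 * (π / 2 * (2 * m + 1)) := by
      rw [← hW]
      gcongr
      exact Wallis.W_le m
    rw [sub_le_iff_le_add, div_le_iff₀ pi_pos]
    have h2 : (m : ℝ) * (2 * m + 1) ≤ (1 + v ^ 2) * π * (2 * m + 1) := by nlinarith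
    exact le_of_mul_le_mul_right h2 (by positivity)
  have h1 : v ≤ √(m / π) := le_sqrt_of_sq_le hu
  have h2 : √(m / π) ≤ v + 1 := by
    rw [sqrt_le_left (by positivity)]
    nlinarith
  rw [abs_sub_le_iff]
  constructor <;> linarith

theorem sum_choose_mul_four_pow (N : ℕ) :
    ∑ j ∈ Finset.range (N + 1), (N.choose j : ℝ) * 4 ^ j / 5 ^ N = 1 := by
  have h := add_pow (4 : ℝ) 1 N
  rw [← Finset.sum_div, div_eq_one_iff_eq (by positivity)]
  norm_num at h
  rw [h]
  exact Finset.sum_congr rfl fun j _ => mul_comm _ _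

/-- The variance of the binomial distribution with parameters `N` and `4 / 5`. -/
theorem sum_variance (N : ℕ) :
    ∑ j ∈ Finset.range (N + 1), (N.choose j : ℝ) * 4 ^ j / 5 ^ N * ((j : ℝ) - 4 * N / 5) ^ 2 =
      4 * (N : ℝ) / 25 := by
  have h := congrArg (Polynomial.eval (4 / 5 : ℝ)) (bernsteinPolynomial.variance ℝ N)
  simp only [bernsteinPolynomial, Polynomial.eval_finsetSum, Polynomial.eval_mul,
    Polynomial.eval_pow, Polynomial.eval_sub, Polynomial.eval_natCast, Polynomial.eval_X,
    Polynomial.eval_one, nsmul_eq_mul] at h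
  have h' : (N : ℝ) * (4 / 5) * (1 - 4 / 5) = 4 * N / 25 := by ring
  rw [← h', ← h]
  refine Finset.sum_congr rfl fun j hj => ?_
  have hj : j ≤ N := Nat.lt_succ_iff.1 (Finset.mem_range.1 hj)
  have h5 : (5 : ℝ) ^ N = 5 ^ j * 5 ^ (N - j) := by rw [← pow_add, Nat.add_sub_cancel' hj]
  rw [h5, show (1 - 4 / 5 : ℝ) = 1 / 5 by norm_num, div_pow, div_pow, one_pow]
  field_simp
  ring

theorem abs_sqrt_sub_sqrt_le {x μ : ℝ} (hx : 0 ≤ x) (hμ : 0 < μ) :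
    |√x - √μ| ≤ ((x - μ) ^ 2 / μ + 1) / 2 := by
  have hs : 0 < √μ := sqrt_pos.2 hμ
  have h1 : |√x - √μ| ≤ |x - μ| / √μ := by
    rw [le_div_iff₀ hs]
    have h2 : x - μ = (√x - √μ) * (√x + √μ) := by
      linear_combination -(mul_self_sqrt hx) + mul_self_sqrt hμ.le
    rw [h2, abs_mul, abs_of_nonneg (a := √x + √μ) (by positivity)]
    gcongr
    linarith [sqrt_nonneg x]
  have h3 : (x - μ) ^ 2 / μ = (|x - μ| / √μ) ^ 2 := by
    rw [div_pow, sq_abs, sq_sqrt hμ.le]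
  rw [h3]
  nlinarith [sq_nonneg (|x - μ| / √μ - 1)]

/-- The mean over the binomial distribution with parameters `N` and `4 / 5` of a function that is
`√(j / π)` up to a bounded error is `√(4N / 5π)` up to a bounded error. -/
theorem abs_mean_sub_le {V : ℕ → ℝ} (hV : ∀ j, |V j - √(j / π)| ≤ 2) {N : ℕ} (hN : N ≠ 0) :
    |∑ j ∈ Finset.range (N + 1), (N.choose j : ℝ) * 4 ^ j / 5 ^ N * V j -
      √(4 * N / 5 / π)| ≤ 3 := by
  have hN' : (0 : ℝ) < N := Nat.cast_pos.2 (Nat.pos_of_ne_zero hN)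
  set μ : ℝ := 4 * N / 5 with hμ
  have hμ0 : 0 < μ := by positivity
  have hterm : ∀ j : ℕ, |V j - √(μ / π)| ≤ 2 + ((j - μ) ^ 2 / μ + 1) / 2 := by
    intro j
    have h1 : |√(j / π) - √(μ / π)| ≤ |√j - √μ| := by
      rw [sqrt_div' _ pi_pos.le, sqrt_div' _ pi_pos.le, ← sub_div, abs_div,
        abs_of_nonneg (sqrt_nonneg π)]
      refine div_le_self (abs_nonneg _) ?_
      rw [one_le_sqrt]
      linarith [pi_gt_three]
    calc |V j - √(μ / π)| ≤ |V j - √(j / π)| + |√(j / π) - √(μ / π)| := abs_sub_le _ _ _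
      _ ≤ 2 + ((j - μ) ^ 2 / μ + 1) / 2 :=
        add_le_add (hV j) (h1.trans (abs_sqrt_sub_sqrt_le (Nat.cast_nonneg j) hμ0))
  have hsum : ∑ j ∈ Finset.range (N + 1), (N.choose j : ℝ) * 4 ^ j / 5 ^ N * V j - √(μ / π) =
      ∑ j ∈ Finset.range (N + 1), (N.choose j : ℝ) * 4 ^ j / 5 ^ N * (V j - √(μ / π)) := by
    simp only [mul_sub, Finset.sum_sub_distrib]
    rw [← Finset.sum_mul, sum_choose_mul_four_pow, one_mul]
  rw [hsum]
  calc _ ≤ ∑ j ∈ Finset.range (N + 1), |(N.choose j : ℝ) * 4 ^ j / 5 ^ N * (V j - √(μ / π))| :=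
        Finset.abs_sum_le_sum_abs _ _
    _ ≤ ∑ j ∈ Finset.range (N + 1),
        (N.choose j : ℝ) * 4 ^ j / 5 ^ N * (2 + ((j - μ) ^ 2 / μ + 1) / 2) := by
      refine Finset.sum_le_sum fun j _ => ?_
      rw [abs_mul, abs_of_nonneg (a := (N.choose j : ℝ) * 4 ^ j / 5 ^ N) (by positivity)]
      gcongr
      exact hterm j
    _ = 5 / 2 * ∑ j ∈ Finset.range (N + 1), (N.choose j : ℝ) * 4 ^ j / 5 ^ N +
        (∑ j ∈ Finset.range (N + 1), (N.choose j : ℝ) * 4 ^ j / 5 ^ N * (j - μ) ^ 2) / (2 * μ) := by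
      rw [Finset.mul_sum, Finset.sum_div, ← Finset.sum_add_distrib]
      refine Finset.sum_congr rfl fun j _ => ?_
      field_simp
      ring
    _ ≤ 3 := by
      rw [sum_choose_mul_four_pow, hμ, sum_variance]
      have : 4 * (N : ℝ) / 25 / (2 * (4 * N / 5)) = 1 / 10 := by
        field_simp
        norm_num
      rw [this]
      norm_num

/-- `scaledCentralBinom`, shifted by one, with value `0` at `0`. -/
noncomputable def shiftedCentralBinom : ℕ → ℝ
  | 0 => 0
  | m + 1 => scaledCentralBinom m

theorem abs_shiftedCentralBinom_sub_le (j : ℕ) : |shiftedCentralBinom j - √(j / π)| ≤ 2 := by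
  cases j with
  | zero => simp [shiftedCentralBinom]
  | succ m =>
    have h1 : √((m + 1 : ℕ) / π) ≤ √(m / π) + 1 := by
      rw [sqrt_le_left (by positivity), add_sq, sq_sqrt (by positivity)]
      have : 1 / π ≤ 1 := by
        rw [div_le_one pi_pos]
        linarith [pi_gt_three]
      push_cast
      rw [add_div]
      nlinarith [sqrt_nonneg (m / π)]
    have h2 : √(m / π) ≤ √((m + 1 : ℕ) / π) := by
      gcongr
      exact m.le_succ
    have h3 := abs_sub_le_iff.1 (abs_scaledCentralBinom_sub_le m)
    rw [shiftedCentralBinom, abs_sub_le_iff]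
    constructor <;> linarith

/-- The number of rooted trees as a mean over a binomial distribution. The factor `n (n + 1)`
turns `C(n - 1, m - 1) * catalan m` into `C(n + 1, m + 1) * m * C(2m, m)`. -/
theorem rootedCount_mul_eq {n : ℕ} (hn : 1 ≤ n) :
    (n : ℝ) * (n + 1) * rootedCount n = 5 ^ (n + 1) / 4 *
      ∑ j ∈ Finset.range (n + 1 + 1),
        ((n + 1).choose j : ℝ) * 4 ^ j / 5 ^ (n + 1) * shiftedCentralBinom j := by
  rw [rootedCount_eq_sum, Finset.sum_range_succ' _ (n + 1), shiftedCentralBinom, mul_zero, add_zero,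
    Nat.cast_sum, Finset.mul_sum, Finset.mul_sum]
  refine Finset.sum_congr rfl fun m _ => ?_
  rcases m with _ | m
  · rw [rootedEdgeCount_zero_left hn]
    simp [shiftedCentralBinom, scaledCentralBinom]
  · obtain ⟨k, rfl⟩ : ∃ k, n = k + 1 := ⟨n - 1, by omega⟩
    have h1 : ((k : ℝ) + 1) * k.choose m = (k + 1).choose (m + 1) * (m + 1) := by
      exact_mod_cast Nat.add_one_mul_choose_eq k m
    have h2 : ((k : ℝ) + 1 + 1) * (k + 1).choose (m + 1) =
        (k + 1 + 1).choose (m + 1 + 1) * (m + 1 + 1) := by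
      exact_mod_cast Nat.add_one_mul_choose_eq (k + 1) (m + 1)
    have h3 : ((m : ℝ) + 1 + 1) * catalan (m + 1) = Nat.centralBinom (m + 1) := by
      exact_mod_cast succ_mul_catalan_eq_centralBinom (m + 1)
    rw [rootedEdgeCount_eq_choose (by omega) (by omega), shiftedCentralBinom, scaledCentralBinom,
      ← h3]
    simp only [Nat.add_sub_cancel]
    push_cast
    have h4 : ∀ x y : ℝ, (5 : ℝ) ^ (k + 1 + 1) / 4 *
        (x * 4 ^ (m + 1 + 1) / 5 ^ (k + 1 + 1) * (y / 4 ^ (m + 1))) = x * y := by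
      intro x y
      field_simp
      ring
    rw [h4]
    linear_combination ((k : ℝ) + 1 + 1) * catalan (m + 1) * h1 +
      ((m : ℝ) + 1) * catalan (m + 1) * h2

theorem rootedCount_isEquivalent :
    Asymptotics.IsEquivalent atTop (fun n : ℕ => (rootedCount n : ℝ))
      (fun n : ℕ => 1 / 2 * √(5 / π) * 5 ^ n * (n : ℝ) ^ (-(3 / 2) : ℝ)) := by
  set E : ℕ → ℝ := fun n => ∑ j ∈ Finset.range (n + 1 + 1),
    ((n + 1).choose j : ℝ) * 4 ^ j / 5 ^ (n + 1) * shiftedCentralBinom j with hE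
  have hs : Tendsto (fun n : ℕ => √(4 * ((n + 1 : ℕ) : ℝ) / 5 / π)) atTop atTop := by
    refine tendsto_sqrt_atTop.comp (Tendsto.atTop_div_const pi_pos
      (Tendsto.atTop_div_const (by norm_num) (Tendsto.const_mul_atTop (by norm_num) ?_)))
    exact tendsto_natCast_atTop_atTop.comp (tendsto_add_atTop_nat 1)
  have hE' : Asymptotics.IsEquivalent atTop E
      (fun n : ℕ => √(4 * ((n + 1 : ℕ) : ℝ) / 5 / π)) := by
    have h1 : (E - fun n : ℕ => √(4 * ((n + 1 : ℕ) : ℝ) / 5 / π)) =O[atTop]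
        (fun _ => (1 : ℝ)) := by
      refine Asymptotics.IsBigO.of_bound 3 (Eventually.of_forall fun n => ?_)
      rw [norm_one, mul_one]
      exact abs_mean_sub_le abs_shiftedCentralBinom_sub_le n.succ_ne_zero
    exact h1.trans_isLittleO ((Asymptotics.isLittleO_one_left_iff ℝ).2
      (tendsto_norm_atTop_atTop.comp hs))
  have hc := (Asymptotics.IsEquivalent.refl (l := atTop)
    (u := fun n : ℕ => (5 : ℝ) ^ (n + 1) / 4 / (n * (n + 1)))).mul hE'
  have hr : Asymptotics.IsEquivalent atTop (fun n : ℕ => √((n : ℝ) / (n + 1)))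
      (fun _ => (1 : ℝ)) := by
    refine (Asymptotics.isEquivalent_const_iff_tendsto one_ne_zero).2 ?_
    simpa using (tendsto_natCast_div_add_atTop (1 : ℝ)).sqrt
  have hg := hr.mul (Asymptotics.IsEquivalent.refl (l := atTop)
    (u := fun n : ℕ => 1 / 2 * √(5 / π) * 5 ^ n * (n : ℝ) ^ (-(3 / 2) : ℝ)))
  refine (hc.congr_left ?_).trans (hg.congr_left ?_ |>.congr_right ?_)
  · filter_upwards [eventually_ge_atTop 1] with n hn
    have hn' : (0 : ℝ) < n := Nat.cast_pos.2 hn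
    have := rootedCount_mul_eq hn
    simp only [Pi.mul_apply, hE]
    rw [div_mul_eq_mul_div, ← this]
    field_simp
  · filter_upwards [eventually_ge_atTop 1] with n hn
    have hn' : (0 : ℝ) < n := Nat.cast_pos.2 hn
    simp only [Pi.mul_apply]
    have hpow : (n : ℝ) ^ (-(3 / 2) : ℝ) = 1 / (n * √n) := by
      rw [rpow_neg hn'.le, show (3 / 2 : ℝ) = 1 + 1 / 2 by norm_num, rpow_add hn', rpow_one,
        ← sqrt_eq_rpow, one_div]
    have h4 : √(4 : ℝ) = 2 := by
      rw [show (4 : ℝ) = 2 ^ 2 by norm_num]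
      exact sqrt_sq (by norm_num)
    have h5 : (√5 : ℝ) ^ 2 = 5 := sq_sqrt (by norm_num)
    have h6 : √((n : ℝ) + 1) ^ 2 = n + 1 := sq_sqrt (by positivity)
    rw [hpow, sqrt_div hn'.le, sqrt_div (by norm_num), sqrt_div (by positivity),
      sqrt_div (by positivity), sqrt_mul (by norm_num), h4]
    push_cast
    have hx : 0 < √((n : ℝ) + 1) := by positivity
    have hy : 0 < √(n : ℝ) := by positivity
    have hz : 0 < √π := by positivity
    field_simp
    rw [h5, h6]
    ring
  · exact Eventually.of_forall fun n => one_mul _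

end Asymptotics

/-! ### The enumeration of weighted trees -/

theorem theorem1 :
    -- the numbers of isomorphism classes are finite
    (∀ n, (RootedWeightedTree.classes n).Finite ∧ (WeightedTree.classes n).Finite) ∧
    -- `f = (1 - t - √(1 - 6t + 5t²)) / (2t)`, with the square root of constant term `1`
    (∃ S : PowerSeries ℚ,
      S ^ 2 = 1 - 6 * PowerSeries.X + 5 * PowerSeries.X ^ 2 ∧
      PowerSeries.constantCoeff S = 1 ∧
      2 * PowerSeries.X * rootedSeries = 1 - PowerSeries.X - S) ∧
    (rootedCount 0 = 1 ∧ rootedCount 1 = 1 ∧ rootedCount 2 = 3 ∧ rootedCount 3 = 10 ∧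
      rootedCount 4 = 36 ∧ rootedCount 5 = 137 ∧ rootedCount 6 = 543 ∧
      rootedCount 7 = 2219 ∧ rootedCount 8 = 9285) ∧
    (∀ n, 1 ≤ n → rootedCount (n + 1) =
      rootedCount n + ∑ k ∈ Finset.range (n + 1), rootedCount k * rootedCount (n - k)) ∧
    Asymptotics.IsEquivalent Filter.atTop (fun n : ℕ => (rootedCount n : ℝ))
      (fun n : ℕ => 1 / 2 * √(5 / Real.pi) * 5 ^ n * (n : ℝ) ^ (-(3 / 2) : ℝ)) ∧
    -- `h = (1 - t - √(1 - (2 + 4s)t + (1 + 4s)t²)) / (2st)`, likewise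
    (∃ S : MvPowerSeries (Fin 2) ℚ,
      S ^ 2 = 1 - (2 + 4 * MvPowerSeries.X 0) * MvPowerSeries.X 1
        + (1 + 4 * MvPowerSeries.X 0) * MvPowerSeries.X 1 ^ 2 ∧
      MvPowerSeries.constantCoeff S = 1 ∧
      2 * MvPowerSeries.X 0 * MvPowerSeries.X 1 * rootedEdgeSeries
        = 1 - MvPowerSeries.X 1 - S) ∧
    (rootedEdgeCount 0 0 = 1 ∧
      (∀ n, 1 ≤ n → rootedEdgeCount 0 n = 0) ∧ (∀ m, 1 ≤ m → rootedEdgeCount m 0 = 0) ∧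
      rootedEdgeCount 1 1 = 1 ∧
      rootedEdgeCount 1 2 = 1 ∧ rootedEdgeCount 2 2 = 2 ∧
      rootedEdgeCount 1 3 = 1 ∧ rootedEdgeCount 2 3 = 4 ∧ rootedEdgeCount 3 3 = 5 ∧
      rootedEdgeCount 1 4 = 1 ∧ rootedEdgeCount 2 4 = 6 ∧ rootedEdgeCount 3 4 = 15 ∧
      rootedEdgeCount 4 4 = 14) ∧
    (∀ m n, 1 ≤ m → 1 ≤ n →
      rootedEdgeCount m n = (n - 1).choose (m - 1) * catalan m ∧
      (rootedEdgeCount m n : ℚ) =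
        ((n - 1).choose (m - 1) : ℚ) * (1 / ((m : ℚ) + 1) * ((2 * m).choose m : ℚ))) ∧
    (∀ n, 1 ≤ n →
      unrootedCount n = ∑ m ∈ Finset.Icc 1 n, (rootedEdgeCount m n : ℚ) / (m : ℚ)) := by
  obtain ⟨h11, h12, h22, h13, h23, h33, h14, h24, h34, h44⟩ := rootedEdgeCount_values
  refine ⟨fun n => ⟨RootedWeightedTree.classes_finite n, WeightedTree.classes_finite n⟩,
    exists_sqrt_rootedSeries, ⟨rootedCount_zero, rootedCount_one, rootedCount_values⟩,
    fun n hn => rootedCount_succ hn, rootedCount_isEquivalent, exists_sqrt_rootedEdgeSeries,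
    ⟨rootedEdgeCount_zero_zero, fun n => rootedEdgeCount_zero_left,
      fun m => rootedEdgeCount_eq_zero_of_lt, h11, h12, h22, h13, h23, h33, h14, h24, h34, h44⟩,
    fun m n hm hn => ⟨rootedEdgeCount_eq_choose hm hn, ?_⟩, fun n => unrootedCount_eq⟩
  rw [rootedEdgeCount_eq_choose hm hn, Nat.cast_mul, catalan_eq_cast]
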